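/- Conventions. Let $A$ be a commutative ring, $S=\mathrm{Spec}(A)$. A category over $S$ is an $A$-linear abelian category $\mathcal C'$ that has small inductive limits, with exact filtered ones. For an $A$-module $M$ and $X\in\mathcal C'$, the object $M\otimes_A X$ (also written $M\ast X$) is the cokernel of the map $X^{(I)}\to X^{(J)}$ given by the matrix of a presentation $A^{(I)}\to A^{(J)}\to M\to 0$; $X$ is called $\mathcal O_S$-flat if $M\mapsto M\otimes_A X$ is exact on $A$-modules. For $f\colon S'=\mathrm{Spec}(R)\to S$, the category $\mathcal C'\times_{S,f} S'$ over $S'$ has as objects the objects of $\mathcal C'$ with an action of $R$ such that the two actions of $A$ coincide, and $f^*\colon \mathcal C'\to\mathcal C'\times_{S,f} S'$ is $X\mapsto R\otimes_A X$. Let $\mathcal G\rightrightarrows S$ be a groupoid scheme with $\mathcal G=\mathrm{Spec}(B)$ affine, whose two projections $p_1,p_2\colon\mathcal G\to S$ are flat. An action of $\mathcal G$ on a category $\mathcal C'$ over $S$ is a functor $\mathrm{act}^*\colon \mathcal C'\to\mathcal C'\times_{S,p_1}\mathcal G$ that is right exact, commutes with inductive limits, and is $\mathcal O_S$-linear when the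 target is regarded as a category over $S$ via $p_2$, together with an isomorphism of functors $1_{\mathcal G}^*\circ\mathrm{act}^*\simeq\mathrm{id}_{\mathcal C'}$ (where $1_{\mathcal G}\colon S\to\mathcal G$ is the unit) and an isomorphism $$\mathrm{mult}^*\circ\mathrm{act}^*\simeq(\mathrm{act}^*\times\mathrm{id}_{\mathcal G})\circ\mathrm{act}^*\colon\ \mathcal C'\to\mathcal C'\times_{S,p_1}(\mathcal G\times_{p_2,S,p_1}\mathcal G),$$ which satisfy the usual unit and associativity compatibility conditions. Lemma 14. Suppose that $\mathcal G$ acts on $\mathcal C'$. (a) Let $0\to\mathcal F_1\to\mathcal F_2\to\mathcal F_3\to0$ be a short exact sequence of quasi-coherent sheaves on $\mathcal G$ (that is, of $B$-modules) such that $\mathcal F_3$ is $\mathcal O_S$-flat with respect to $p_2$. Then for every $X\in\mathcal C'$ the sequence $$0\to\mathcal F_1\ast\mathrm{act}^*(X)\to\mathcal F_2\ast\mathrm{act}^*(X)\to\mathcal F_3\ast\mathrm{act}^*(X)\to0$$ in $\mathcal C'\times_{S,p_1}\mathcal G$, where $\ast$ is the tensor product over $B$, is short exact. (b) If $X\in\mathcal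 C'$ is $\mathcal O_S$-flat, then $\mathrm{act}^*(X)$ is $\mathcal O_{\mathcal G}$-flat, i.e. $\mathcal F\mapsto\mathcal F\ast\mathrm{act}^*(X)$ is exact on $B$-modules. -/

import Mathlib

open CategoryTheory CategoryTheory.Limits TensorProduct

universe v u

noncomputable section

/-! ## Tensoring objects of a linear category by modules -/

namespace LinTensor

section

variable {R : Type v} [CommRing R] {E : Type u} [Category.{v} E] [Preadditive E] [Linear R E]
  [HasColimits E]

/-- The relations of the standard presentation `R^(I) → R^(M) → M → 0` of a module `M`. -/
abbrev Rel (R : Type v) [CommRing R] (M : Type v) [AddCommGroup M] [Module R M] : Type v :=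
  LinearMap.ker (Finsupp.linearCombination R (id : M → M))

variable (R) in
/-- The map `X^(I) ⟶ X^(M)` given by the matrix of the standard presentation of `M`. -/
def relMap (M : Type v) [AddCommGroup M] [Module R M] (X : E) :
    (∐ fun _ : Rel R M => X) ⟶ (∐ fun _ : M => X) :=
  Sigma.desc fun r => r.1.sum fun m c => c • Sigma.ι (fun _ : M => X) m

variable (R) in
/-- The tensor product `M ⊗_R X` of an `R`-module and an object of an `R`-linear category:
the cokernel of `X^(I) ⟶ X^(M)` for the standard presentation of `M`. -/
def tens (M : Type v) [AddCommGroup M] [Module R M] (X : E) : E :=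
  cokernel (relMap R M X)

variable {M N P : Type v} [AddCommGroup M] [Module R M] [AddCommGroup N] [Module R N]
  [AddCommGroup P] [Module R P]

/-- The map `X ⟶ M ⊗_R X`, written `x ↦ m ⊗ x`. -/
def mkFun (X : E) (m : M) : X ⟶ tens R M X :=
  Sigma.ι (fun _ : M => X) m ≫ cokernel.π (relMap R M X)

theorem mkFun_rel (X : E) (r : M →₀ R) (hr : Finsupp.linearCombination R (id : M → M) r = 0) :
    (r.sum fun m c => c • mkFun (R := R) X m) = 0 := by
  have h := Sigma.ι (fun _ : Rel R M => X) ⟨r, hr⟩ ≫= cokernel.condition (relMap R M X)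
  have h' : Sigma.ι (fun _ : Rel R M => X) ⟨r, hr⟩ ≫ relMap R M X =
      r.sum fun m c => c • Sigma.ι (fun _ : M => X) m := by
    rw [relMap, Sigma.ι_desc]
  rw [comp_zero, ← Category.assoc, h', Finsupp.sum, Preadditive.sum_comp] at h
  simp only [Linear.smul_comp] at h
  exact h

/-- The `R`-linear map `m ↦ (x ↦ m ⊗ x)`. -/
def mk (X : E) : M →ₗ[R] (X ⟶ tens R M X) where
  toFun := mkFun X
  map_add' m n := by
    classical
    have h := mkFun_rel (R := R) X
      (Finsupp.single (m + n) 1 - Finsupp.single m 1 - Finsupp.single n 1) (by simp)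
    rw [Finsupp.sum_sub_index (by intros; simp [sub_smul]),
      Finsupp.sum_sub_index (by intros; simp [sub_smul])] at h
    simp only [zero_smul, Finsupp.sum_single_index, one_smul] at h
    rw [sub_sub, sub_eq_zero] at h
    exact h
  map_smul' c m := by
    classical
    have h := mkFun_rel (R := R) X
      (Finsupp.single (c • m) 1 - Finsupp.single m c) (by simp)
    rw [Finsupp.sum_sub_index (by intros; simp [sub_smul])] at h
    simp only [zero_smul, Finsupp.sum_single_index, one_smul] at h
    rw [sub_eq_zero] at h
    exact h

/-- The universal property of `M ⊗_R X`: maps out of it are `R`-linear maps `M → Hom(X, Y)`. -/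
def desc {X Y : E} (g : M →ₗ[R] (X ⟶ Y)) : tens R M X ⟶ Y :=
  cokernel.desc _ (Sigma.desc fun m => g m) <| by
    apply Sigma.hom_ext
    intro r
    have h := congrArg g r.2
    rw [Finsupp.linearCombination_apply, Finsupp.sum, map_sum, map_zero] at h
    simp only [id, map_smul] at h
    rw [comp_zero, ← Category.assoc, relMap, Sigma.ι_desc, ← h]
    simp [Finsupp.sum, Preadditive.sum_comp, Linear.smul_comp]

@[simp]
theorem mk_desc {X Y : E} (g : M →ₗ[R] (X ⟶ Y)) (m : M) : mk X m ≫ desc g = g m := by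
  change (Sigma.ι (fun _ : M => X) m ≫ cokernel.π (relMap R M X)) ≫ cokernel.desc _ _ _ = _
  rw [Category.assoc, cokernel.π_desc, Sigma.ι_desc]

theorem hom_ext {X Y : E} {f g : tens R M X ⟶ Y} (h : ∀ m : M, mk X m ≫ f = mk X m ≫ g) :
    f = g := by
  unfold tens at f g
  apply (cancel_epi (cokernel.π (relMap R M X))).1
  apply Sigma.hom_ext
  intro m
  have h' : (Sigma.ι (fun _ : M => X) m ≫ cokernel.π (relMap R M X)) ≫ f =
    (Sigma.ι (fun _ : M => X) m ≫ cokernel.π (relMap R M X)) ≫ g := h m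
  simpa only [Category.assoc] using h'

/-- Functoriality of `M ⊗_R X` in both variables. -/
def map {X Y : E} (φ : M →ₗ[R] N) (h : X ⟶ Y) : tens R M X ⟶ tens R N Y :=
  desc ((Linear.leftComp R (tens R N Y) h).comp ((mk Y).comp φ))

@[simp]
theorem mk_map {X Y : E} (φ : M →ₗ[R] N) (h : X ⟶ Y) (m : M) :
    mk X m ≫ map φ h = h ≫ mk Y (φ m) := by
  simp [map]

theorem map_id (X : E) : map (LinearMap.id : M →ₗ[R] M) (𝟙 X) = 𝟙 _ :=
  hom_ext fun m => by simp

theorem map_comp {X Y Z : E} (φ : M →ₗ[R] N) (ψ : N →ₗ[R] P) (h : X ⟶ Y) (k : Y ⟶ Z) :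
    map (ψ.comp φ) (h ≫ k) = map φ h ≫ map ψ k :=
  hom_ext fun m => by
    rw [mk_map, ← Category.assoc, mk_map, Category.assoc, Category.assoc, mk_map]; simp

theorem map_add_left {X Y : E} (φ ψ : M →ₗ[R] N) (h : X ⟶ Y) :
    map (φ + ψ) h = map φ h + map ψ h :=
  hom_ext fun m => by simp [Preadditive.comp_add]

/-- The functor `M ↦ M ⊗_R X` from `R`-modules to `E`. -/
@[simps]
def functor (R : Type v) [CommRing R] [Linear R E] (X : E) : ModuleCat.{v} R ⥤ E where
  obj M := tens R M X
  map φ := map φ.hom (𝟙 X)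
  map_id M := map_id X
  map_comp φ ψ := by
    rw [← map_comp, Category.comp_id, ModuleCat.hom_comp]

instance (X : E) : (functor R X).Additive where
  map_add := by
    intro M N f g
    exact map_add_left f.hom g.hom (𝟙 X)

/-- An object `X` of an `R`-linear category is flat over `R` if the functor
`M ↦ M ⊗_R X` is exact. -/
def IsFlat (R : Type v) [CommRing R] [Linear R E] (X : E) : Prop :=
  ∀ S : ShortComplex (ModuleCat.{v} R), S.ShortExact → (S.map (functor R X)).ShortExact

end

end LinTensor

/-! ## Fibre products of affine schemes -/

/-- The ring `R`, regarded as an `A`-algebra through the homomorphism `f : A →+* R`. -/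
def AlgOf {A R : Type v} [CommRing A] [CommRing R] (_f : A →+* R) : Type v := R

namespace AlgOf

variable {A R : Type v} [CommRing A] [CommRing R] (f : A →+* R)

instance : CommRing (AlgOf f) := inferInstanceAs (CommRing R)

instance : Algebra A (AlgOf f) := RingHom.toAlgebra f

end AlgOf

section FibreProduct

variable {A R R' : Type v} [CommRing A] [CommRing R] [CommRing R']

/-- The coordinate ring `R ⊗_A R'` of the fibre product of `Spec R` and `Spec R'` over `Spec A`,
for the structure maps given by `f : A →+* R` and `g : A →+* R'`. -/
abbrev Fib (f : A →+* R) (g : A →+* R') : Type v := AlgOf f ⊗[A] AlgOf g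

variable (f : A →+* R) (g : A →+* R')

/-- The homomorphism `R →+* R ⊗_A R'` dual to the first projection. -/
def Fib.inl : R →+* Fib f g :=
  (Algebra.TensorProduct.includeLeft : AlgOf f →ₐ[A] Fib f g).toRingHom

/-- The homomorphism `R' →+* R ⊗_A R'` dual to the second projection. -/
def Fib.inr : R' →+* Fib f g :=
  (Algebra.TensorProduct.includeRight : AlgOf g →ₐ[A] Fib f g).toRingHom

/-- The homomorphism `R ⊗_A R' →+* T`, `r ⊗ r' ↦ r • β r'`, for an `R`-algebra `T`, possibly not
commutative, and a homomorphism `β : R' →+* T` that agrees with `A →+* R` on `A`. -/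
def Fib.liftAlg {T : Type v} [Ring T] [Algebra R T] (β : R' →+* T)
    (h : ∀ a, algebraMap R T (f a) = β (g a)) : Fib f g →+* T :=
  letI : Algebra A T := Algebra.compHom T f
  (Algebra.TensorProduct.lift (R := A) (S := A) (A := AlgOf f) (B := AlgOf g)
    ({ toRingHom := (algebraMap R T : R →+* T)
       commutes' := fun _ => rfl } : AlgOf f →ₐ[A] T)
    ({ toRingHom := β
       commutes' := fun a => (h a).symm } : AlgOf g →ₐ[A] T)
    (fun x _ => Algebra.commutes (A := T) (R := R) x _)).toRingHom

theorem Fib.liftAlg_tmul {T : Type v} [Ring T] [Algebra R T] (β : R' →+* T)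
    (h : ∀ a, algebraMap R T (f a) = β (g a)) (x : R) (y : R') :
    Fib.liftAlg f g β h ((x : AlgOf f) ⊗ₜ[A] (y : AlgOf g)) = algebraMap R T x * β y :=
  rfl

theorem Fib.liftAlg_inl {T : Type v} [Ring T] [Algebra R T] (β : R' →+* T)
    (h : ∀ a, algebraMap R T (f a) = β (g a)) (x : R) :
    Fib.liftAlg f g β h (Fib.inl f g x) = algebraMap R T x := by
  change algebraMap R T x * β 1 = _
  rw [map_one, mul_one]

/-- The homomorphism `R ⊗_A R' →+* T` given by two homomorphisms to a commutative ring `T`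
that agree on `A`, i.e. a `T`-point of the fibre product given by its two components. -/
def Fib.lift {T : Type v} [CommRing T] (α : R →+* T) (β : R' →+* T)
    (h : α.comp f = β.comp g) : Fib f g →+* T :=
  letI : Algebra R T := α.toAlgebra
  Fib.liftAlg f g β (fun a => congrArg (fun k : A →+* T => k a) h)

theorem Fib.lift_inl {T : Type v} [CommRing T] (α : R →+* T) (β : R' →+* T)
    (h : α.comp f = β.comp g) : (Fib.lift f g α β h).comp (Fib.inl f g) = α := by
  ext x
  change α x * β 1 = α x
  rw [map_one, mul_one]

theorem Fib.lift_inr {T : Type v} [CommRing T] (α : R →+* T) (β : R' →+* T)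
    (h : α.comp f = β.comp g) : (Fib.lift f g α β h).comp (Fib.inr f g) = β := by
  ext x
  change α 1 * β x = β x
  rw [map_one, one_mul]

end FibreProduct

/-! ## Affine groupoids -/

/-- A groupoid scheme `𝒢 ⇉ S` with `S = Spec A` and `𝒢 = Spec B` affine, in terms of the
coordinate rings. A `T`-point `x : B →+* T` of `𝒢` is an arrow with end points `x.comp p₁` and
`x.comp p₂`; arrows `x`, `y` with `x.comp p₂ = y.comp p₁` are composable, and the axioms say that
for every commutative ring `T` the `T`-points form a groupoid. -/
structure AffineGroupoid (A B : Type v) [CommRing A] [CommRing B] where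
  /-- the homomorphism dual to `p₁ : 𝒢 → S` -/
  p₁ : A →+* B
  /-- the homomorphism dual to `p₂ : 𝒢 → S` -/
  p₂ : A →+* B
  /-- the homomorphism dual to the unit `1 : S → 𝒢` -/
  unit : B →+* A
  /-- the homomorphism dual to the inversion `𝒢 → 𝒢` -/
  inv : B →+* B
  /-- the homomorphism dual to the multiplication `𝒢 ×_{p₂,S,p₁} 𝒢 → 𝒢` -/
  mult : B →+* Fib p₂ p₁
  unit_p₁ : unit.comp p₁ = RingHom.id A
  unit_p₂ : unit.comp p₂ = RingHom.id A
  inv_p₁ : inv.comp p₁ = p₂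
  inv_p₂ : inv.comp p₂ = p₁
  mult_p₁ : mult.comp p₁ = (Fib.inl p₂ p₁).comp p₁
  mult_p₂ : mult.comp p₂ = (Fib.inr p₂ p₁).comp p₂
  one_mul : ∀ (T : Type v) [CommRing T] (x : B →+* T)
    (h : ((x.comp p₁).comp unit).comp p₂ = x.comp p₁),
    (Fib.lift p₂ p₁ ((x.comp p₁).comp unit) x h).comp mult = x
  mul_one : ∀ (T : Type v) [CommRing T] (x : B →+* T)
    (h : x.comp p₂ = ((x.comp p₂).comp unit).comp p₁),
    (Fib.lift p₂ p₁ x ((x.comp p₂).comp unit) h).comp mult = x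
  mul_inv : ∀ (T : Type v) [CommRing T] (x : B →+* T) (h : x.comp p₂ = (x.comp inv).comp p₁),
    (Fib.lift p₂ p₁ x (x.comp inv) h).comp mult = (x.comp p₁).comp unit
  inv_mul : ∀ (T : Type v) [CommRing T] (x : B →+* T) (h : (x.comp inv).comp p₂ = x.comp p₁),
    (Fib.lift p₂ p₁ (x.comp inv) x h).comp mult = (x.comp p₂).comp unit
  mul_assoc : ∀ (T : Type v) [CommRing T] (x y z : B →+* T)
    (hxy : x.comp p₂ = y.comp p₁) (hyz : y.comp p₂ = z.comp p₁)
    (h : ((Fib.lift p₂ p₁ x y hxy).comp mult).comp p₂ = z.comp p₁)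
    (h' : x.comp p₂ = ((Fib.lift p₂ p₁ y z hyz).comp mult).comp p₁),
    (Fib.lift p₂ p₁ ((Fib.lift p₂ p₁ x y hxy).comp mult) z h).comp mult =
      (Fib.lift p₂ p₁ x ((Fib.lift p₂ p₁ y z hyz).comp mult) h').comp mult

/-- The groupoid is flat if both `p₁` and `p₂` are flat. -/
def AffineGroupoid.IsFlat {A B : Type v} [CommRing A] [CommRing B] (G : AffineGroupoid A B) :
    Prop :=
  G.p₁.Flat ∧ G.p₂.Flat

/-! ## Change of rings for linear categories -/

section BaseChange

variable {A R : Type v} [CommRing A] [CommRing R]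

/-- For an `A`-linear category `C` and `f : A →+* R`, the base-changed category
`C ×_{Spec A} Spec R`: its objects are objects of `C` with an action of `R` such that the two
actions of `A` coincide. -/
structure BaseChange (C : Type u) [Category.{v} C] [Preadditive C] [Linear A C]
    (f : A →+* R) where
  /-- the underlying object -/
  obj : C
  /-- the action of `R` -/
  act : R →+* End obj
  act_algebra : ∀ a : A, act (f a) = End.of (a • 𝟙 obj)

/-- The map on endomorphism rings induced by an additive functor. -/
def mapEndRingHom {C : Type*} [Category* C] [Preadditive C] {D : Type*} [Category* D]
    [Preadditive D] (F : C ⥤ D) [F.Additive] (X : C) : End X →+* End (F.obj X) where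
  __ := F.mapEnd X
  map_zero' := F.map_zero X X
  map_add' _ _ := F.map_add

namespace BaseChange

variable {C : Type u} [Category.{v} C] [Preadditive C] [Linear A C] {f : A →+* R}

/-- Morphisms that commute with the action of `R`. -/
@[ext]
structure Hom (X Y : BaseChange C f) where
  /-- the underlying morphism -/
  hom : X.obj ⟶ Y.obj
  comm : ∀ r, (X.act r).asHom ≫ hom = hom ≫ (Y.act r).asHom

@[simps id_hom comp_hom]
instance : Category.{v} (BaseChange C f) where
  Hom := Hom
  id X := ⟨𝟙 X.obj, by simp⟩
  comp g h := ⟨g.hom ≫ h.hom, fun r => by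
    rw [← Category.assoc, g.comm, Category.assoc, h.comm, Category.assoc]⟩

@[ext]
theorem hom_ext {X Y : BaseChange C f} {g h : X ⟶ Y} (w : g.hom = h.hom) : g = h :=
  Hom.ext w

variable {X Y : BaseChange C f}

instance : Zero (X ⟶ Y) := ⟨⟨0, by simp⟩⟩
instance : Add (X ⟶ Y) :=
  ⟨fun g h => ⟨g.hom + h.hom, by simp [Preadditive.comp_add, Preadditive.add_comp, g.comm, h.comm]⟩⟩
instance : Neg (X ⟶ Y) := ⟨fun g => ⟨-g.hom, by simp [g.comm]⟩⟩
instance : Sub (X ⟶ Y) :=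
  ⟨fun g h => ⟨g.hom - h.hom, by simp [Preadditive.comp_sub, Preadditive.sub_comp, g.comm, h.comm]⟩⟩
instance : SMul ℕ (X ⟶ Y) :=
  ⟨fun n g => ⟨n • g.hom, by simp [g.comm]⟩⟩
instance : SMul ℤ (X ⟶ Y) :=
  ⟨fun n g => ⟨n • g.hom, by simp [g.comm]⟩⟩

theorem act_mul_comp (X : BaseChange C f) (r s : R) :
    (X.act (r * s)).asHom = (X.act r).asHom ≫ (X.act s).asHom := by
  rw [mul_comm, map_mul]; rfl

/-- The action of `R` on morphisms. -/
instance : SMul R (X ⟶ Y) :=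
  ⟨fun r g => ⟨(X.act r).asHom ≫ g.hom, fun s => by
    rw [← Category.assoc, ← act_mul_comp, mul_comm, act_mul_comp, Category.assoc, Category.assoc,
      g.comm]⟩⟩

@[simp] theorem zero_hom : (0 : X ⟶ Y).hom = 0 := rfl
@[simp] theorem add_hom (g h : X ⟶ Y) : (g + h).hom = g.hom + h.hom := rfl
@[simp] theorem smul_hom (r : R) (g : X ⟶ Y) : (r • g).hom = (X.act r).asHom ≫ g.hom := rfl

instance : AddCommGroup (X ⟶ Y) :=
  Function.Injective.addCommGroup (fun g : X ⟶ Y => g.hom) (fun _ _ => hom_ext)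
    rfl (fun _ _ => rfl) (fun _ => rfl) (fun _ _ => rfl) (fun _ _ => rfl) (fun _ _ => rfl)

instance : Preadditive (BaseChange C f) where
  add_comp _ _ _ _ _ _ := hom_ext (Preadditive.add_comp ..)
  comp_add _ _ _ _ _ _ := hom_ext (Preadditive.comp_add ..)

instance : Module R (X ⟶ Y) where
  one_smul g := hom_ext <| by rw [smul_hom, map_one]; exact Category.id_comp _
  mul_smul r s g := hom_ext <| by
    rw [smul_hom, act_mul_comp, Category.assoc, smul_hom, smul_hom]
  smul_zero r := hom_ext comp_zero
  smul_add r g h := hom_ext (Preadditive.comp_add ..)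
  add_smul r s g := hom_ext <| by
    rw [smul_hom, map_add]; exact Preadditive.add_comp ..
  zero_smul g := hom_ext <| by
    rw [smul_hom, map_zero]; exact zero_comp

/-- The base-changed category is `R`-linear. -/
instance : Linear R (BaseChange C f) where
  homModule _ _ := inferInstance
  smul_comp _ _ _ r g h := hom_ext (Category.assoc ..)
  comp_smul X Y Z g r h := hom_ext <| by
    change g.hom ≫ (Y.act r).asHom ≫ h.hom = (X.act r).asHom ≫ g.hom ≫ h.hom
    rw [← Category.assoc, ← g.comm, Category.assoc]

variable (C f) in
/-- The functor forgetting the action of `R` (the direct image). -/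
@[simps]
def forget : BaseChange C f ⥤ C where
  obj X := X.obj
  map g := g.hom

instance : (forget C f).Additive where

section Colimits

variable {J : Type v} [SmallCategory J]

/-- The action of `r` on a diagram. -/
def actNat (F : J ⥤ BaseChange C f) (r : R) : F ⋙ forget C f ⟶ F ⋙ forget C f where
  app j := ((F.obj j).act r).asHom
  naturality _ _ g := ((F.map g).comm r).symm

theorem actNat_one (F : J ⥤ BaseChange C f) : actNat F 1 = 𝟙 _ := by
  ext j
  change (F.obj j).act 1 = _
  rw [map_one]; rfl

theorem actNat_zero (F : J ⥤ BaseChange C f) : actNat F 0 = 0 := by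
  ext j
  change (F.obj j).act 0 = _
  rw [map_zero]; rfl

theorem actNat_mul (F : J ⥤ BaseChange C f) (r s : R) :
    actNat F (r * s) = actNat F s ≫ actNat F r := by
  ext j
  change (F.obj j).act (r * s) = _
  rw [map_mul]; rfl

theorem actNat_add (F : J ⥤ BaseChange C f) (r s : R) :
    actNat F (r + s) = actNat F r + actNat F s := by
  ext j
  change (F.obj j).act (r + s) = _
  rw [map_add]; rfl

theorem actNat_algebra (F : J ⥤ BaseChange C f) (a : A) (j : J) :
    (actNat F (f a)).app j = a • 𝟙 ((F ⋙ forget C f).obj j) := by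
  change (F.obj j).act (f a) = _
  rw [act_algebra]; rfl

variable [HasColimitsOfShape J C]

/-- The colimit of the underlying diagram, with the induced action of `R`. -/
def colimitObj (F : J ⥤ BaseChange C f) : BaseChange C f where
  obj := colimit (F ⋙ forget C f)
  act :=
    { toFun := fun r => End.of (colimMap (actNat F r))
      map_one' := colimit.hom_ext fun j => by
        simp [actNat_one]
      map_zero' := colimit.hom_ext fun j => by
        rw [actNat_zero, ι_colimMap, zero_app]
        exact zero_comp.trans comp_zero.symm
      map_mul' := fun r s => colimit.hom_ext fun j => by
        simp [actNat_mul]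
      map_add' := fun r s => colimit.hom_ext fun j => by
        rw [actNat_add, ι_colimMap, NatTrans.app_add, Preadditive.add_comp]
        refine Eq.trans ?_ (Preadditive.comp_add _ _ _ _ _ _).symm
        rw [ι_colimMap, ι_colimMap] }
  act_algebra a := colimit.hom_ext fun j => by
    refine (ι_colimMap (actNat F (f a)) j).trans ?_
    rw [actNat_algebra]
    refine Eq.trans ?_ (Linear.comp_smul _ _ _ _ _ _).symm
    refine (Linear.smul_comp _ _ _ _ _ _).trans ?_
    exact congrArg (a • ·) ((Category.id_comp _).trans (Category.comp_id _).symm)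

/-- The colimit cocone. -/
def colimitCocone (F : J ⥤ BaseChange C f) : Cocone F where
  pt := colimitObj F
  ι :=
    { app := fun j => ⟨colimit.ι (F ⋙ forget C f) j, fun r => (ι_colimMap (actNat F r) j).symm⟩
      naturality := fun _ _ g => hom_ext <|
        (colimit.w (F ⋙ forget C f) g).trans (Category.comp_id _).symm }

/-- The colimit cocone is a colimit. -/
def colimitIsColimit (F : J ⥤ BaseChange C f) : IsColimit (colimitCocone F) where
  desc s := ⟨colimit.desc (F ⋙ forget C f) ((forget C f).mapCocone s), fun r =>
    colimit.hom_ext fun j => by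
      refine (ι_colimMap_assoc (actNat F r) j _).trans ?_
      refine Eq.trans ?_ (colimit.ι_desc_assoc ((forget C f).mapCocone s) j _).symm
      refine (congrArg ((actNat F r).app j ≫ ·)
        (colimit.ι_desc ((forget C f).mapCocone s) j)).trans ?_
      exact (s.ι.app j).comm r⟩
  fac s j := hom_ext (colimit.ι_desc _ _)
  uniq s m w := hom_ext <| colimit.hom_ext fun j =>
    (congrArg Hom.hom (w j)).trans (colimit.ι_desc ((forget C f).mapCocone s) j).symm

end Colimits

instance [HasColimits C] : HasColimits (BaseChange C f) where
  has_colimits_of_shape _ _ :=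
    { has_colimit := fun F => ⟨⟨_, colimitIsColimit F⟩⟩ }

/-- The identification `(C ×_S S') ×_{S'} S'' ⥤ C ×_S S''` for `S'' → S' → S`. -/
def collapse {R' : Type v} [CommRing R'] {g : R →+* R'} {k : A →+* R'} (h : g.comp f = k) :
    BaseChange (BaseChange C f) g ⥤ BaseChange C k where
  obj X :=
    { obj := X.obj.obj
      act := (mapEndRingHom (forget C f) X.obj).comp X.act
      act_algebra := fun a => by
        subst h
        change End.of ((X.act (g (f a))).asHom.hom) = _
        rw [X.act_algebra]
        change (X.obj.act (f a)).asHom ≫ 𝟙 _ = _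
        rw [Category.comp_id, X.obj.act_algebra] }
  map φ := ⟨φ.hom.hom, fun r => congrArg Hom.hom (φ.comm r)⟩

variable {E : Type u} [Category.{v} E] [Preadditive E] [Linear A E] [HasColimits E]

/-- Multiplication by `r : R` on the `A`-module `R`. -/
def mulMap (f : A →+* R) (r : R) : AlgOf f →ₗ[A] AlgOf f :=
  LinearMap.mulLeft A (r : AlgOf f)

theorem map_mulMap_eq {f : A →+* R} {r : R} {X : E} {g : End (LinTensor.tens A (AlgOf f) X)}
    (h : ∀ x : AlgOf f, LinTensor.mk X (M := AlgOf f) (mulMap f r x) =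
      LinTensor.mk X (M := AlgOf f) x ≫ g.asHom) :
    End.of (LinTensor.map (mulMap f r) (𝟙 X)) = g :=
  LinTensor.hom_ext fun m => by
    rw [LinTensor.mk_map, Category.id_comp]; exact h m

/-- The pull-back functor `E ⥤ E ×_{Spec A} Spec R`, `X ↦ R ⊗_A X`. -/
def pull (f : A →+* R) : E ⥤ BaseChange E f where
  obj X :=
    { obj := LinTensor.tens A (AlgOf f) X
      act :=
        { toFun := fun r => End.of (LinTensor.map (mulMap f r) (𝟙 X))
          map_one' := map_mulMap_eq fun x => by
            refine Eq.trans ?_ (Category.comp_id _).symm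
            exact congrArg _ (_root_.one_mul x)
          map_mul' := fun r s => map_mulMap_eq fun x => by
            refine Eq.trans ?_ (Category.assoc _ _ _)
            rw [LinTensor.mk_map, Category.id_comp, LinTensor.mk_map, Category.id_comp]
            exact congrArg _ (_root_.mul_assoc (G := AlgOf f) r s x)
          map_zero' := map_mulMap_eq fun x => by
            refine Eq.trans ?_ comp_zero.symm
            exact (congrArg _ (zero_mul x)).trans (map_zero _)
          map_add' := fun r s => map_mulMap_eq fun x => by
            refine Eq.trans ?_ (Preadditive.comp_add _ _ _ _ _ _).symm
            rw [LinTensor.mk_map, Category.id_comp, LinTensor.mk_map, Category.id_comp, ← map_add]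
            exact congrArg _ (add_mul (R := AlgOf f) r s x) }
      act_algebra := fun a => map_mulMap_eq fun x => by
        refine Eq.trans ?_ (Linear.comp_smul _ _ _ _ _ _).symm
        rw [Category.comp_id, ← map_smul]
        exact congrArg _ (Algebra.smul_def (A := AlgOf f) a x).symm }
  map {X Y} h := ⟨LinTensor.map LinearMap.id h, fun r => by
    change LinTensor.map (mulMap f r) (𝟙 X) ≫ _ = _ ≫ LinTensor.map (mulMap f r) (𝟙 Y)
    rw [← LinTensor.map_comp, ← LinTensor.map_comp, Category.id_comp, Category.comp_id]; rfl⟩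
  map_id X := hom_ext (LinTensor.map_id X)
  map_comp h k := hom_ext (LinTensor.map_comp LinearMap.id LinearMap.id h k)

/-- The canonical map `X ⟶ R ⊗_A X`, `x ↦ 1 ⊗ x`, i.e. the unit of the adjunction between
pull-back and direct image. -/
def toPull (f : A →+* R) (X : E) : X ⟶ ((pull f).obj X).obj :=
  LinTensor.mk X (1 : AlgOf f)

end BaseChange

end BaseChange

/-! ## Groupoid actions -/

namespace GroupoidAction

open BaseChange

variable {A B : Type v} [CommRing A] [CommRing B] {C : Type u} [Category.{v} C] [Preadditive C]
  [Linear A C] {p₁ : A →+* B}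

section ProdId

variable (F : C ⥤ BaseChange C p₁) [F.Additive] (p₂ : A →+* B)
  (hF : ∀ {X Y : C} (a : A) (h : X ⟶ Y), F.map (a • h) = p₂ a • F.map h)
  {A' : Type v} [CommRing A'] (ψ : A →+* A')

/-- For `Y` in `C ×_S S'`, the object `F(Y)` carries its action of `B`, and the action of `A'` that
it gets from the action of `A'` on `Y` by functoriality. Together they are an action of
`B ⊗_A A'`. -/
def prodAct (Y : BaseChange C ψ) : Fib p₂ ψ →+* End (F.obj Y.obj) :=
  Fib.liftAlg p₂ ψ ((mapEndRingHom F Y.obj).comp Y.act) fun a => by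
    change _ = F.map (Y.act (ψ a)).asHom
    rw [Y.act_algebra]
    change _ = F.map (a • 𝟙 _)
    rw [hF, F.map_id]
    rfl

theorem prodAct_tmul (Y : BaseChange C ψ) (b : B) (a' : A') :
    (prodAct F p₂ hF ψ Y ((b : AlgOf p₂) ⊗ₜ[A] (a' : AlgOf ψ))).asHom =
      b • F.map (Y.act a').asHom := by
  change F.map (Y.act a').asHom ≫ (b • 𝟙 _) = _
  rw [Linear.comp_smul, Category.comp_id]

theorem prodAct_inl (Y : BaseChange C ψ) (b : B) :
    (prodAct F p₂ hF ψ Y (Fib.inl p₂ ψ b)).asHom = b • 𝟙 _ := by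
  refine (prodAct_tmul F p₂ hF ψ Y b 1).trans ?_
  rw [map_one]
  exact congrArg (b • ·) (F.map_id _)

theorem prodAct_comm {X Y : BaseChange C ψ} (h : X ⟶ Y) (r : Fib p₂ ψ) :
    (prodAct F p₂ hF ψ X r).asHom ≫ F.map h.hom = F.map h.hom ≫ (prodAct F p₂ hF ψ Y r).asHom := by
  induction r using TensorProduct.induction_on with
  | zero => rw [map_zero, map_zero]; exact zero_comp.trans comp_zero.symm
  | tmul b a' =>
    have := h.comm a'
    refine (congrArg (· ≫ F.map h.hom) (prodAct_tmul F p₂ hF ψ X b a')).trans ?_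
    refine Eq.trans ?_ (congrArg (F.map h.hom ≫ ·) (prodAct_tmul F p₂ hF ψ Y b a')).symm
    have e : F.map (X.act a').asHom ≫ F.map h.hom = F.map h.hom ≫ F.map (Y.act a').asHom := by
      rw [← F.map_comp, this, F.map_comp]
    exact (Linear.smul_comp (R := B) _ _ _ b _ _).trans
      ((congrArg (HSMul.hSMul (α := B) b) e).trans (Linear.comp_smul (R := B) _ _ _ _ b _).symm)
  | add x y hx hy =>
    rw [map_add, map_add]
    refine (Preadditive.add_comp _ _ _ _ _ _).trans ?_
    refine Eq.trans ?_ (Preadditive.comp_add _ _ _ _ _ _).symm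
    exact congrArg₂ (· + ·) hx hy

/-- For a functor `F : C ⥤ C ×_{S,p₁} 𝒢` that is `S`-linear through `p₂`, and `S' → S`, the functor
`F × id : C ×_S S' ⥤ C ×_{S,p₁} (𝒢 ×_{p₂,S} S')`. -/
def prodId : BaseChange C ψ ⥤ BaseChange C ((Fib.inl p₂ ψ).comp p₁) where
  obj Y :=
    { obj := (F.obj Y.obj).obj
      act := (mapEndRingHom (BaseChange.forget C p₁) (F.obj Y.obj)).comp (prodAct F p₂ hF ψ Y)
      act_algebra := fun a => by
        refine (congrArg BaseChange.Hom.hom (prodAct_inl F p₂ hF ψ Y (p₁ a))).trans ?_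
        change ((F.obj Y.obj).act (p₁ a)).asHom ≫ 𝟙 _ = _
        rw [Category.comp_id, act_algebra] }
  map h := ⟨(F.map h.hom).hom, fun r => congrArg BaseChange.Hom.hom (prodAct_comm F p₂ hF ψ h r)⟩
  map_id X := BaseChange.hom_ext <|
    congrArg (fun k : F.obj X.obj ⟶ F.obj X.obj => k.hom) (F.map_id X.obj)
  map_comp {X Y Z} g h := BaseChange.hom_ext <|
    congrArg (fun k : F.obj X.obj ⟶ F.obj Z.obj => k.hom) (F.map_comp g.hom h.hom)

end ProdId

end GroupoidAction

open BaseChange GroupoidAction in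
/-- The data of an action of the affine groupoid `𝒢 ⇉ S` on a category `C` over `S`: an
`S`-linear functor `act^* : C ⥤ C ×_{S,p₁} 𝒢`, where the target is a category over `S` via `p₂`,
that is right exact and commutes with inductive limits, a unit constraint and an associativity
constraint. -/
structure GroupoidActionData {A B : Type v} [CommRing A] [CommRing B] (G : AffineGroupoid A B)
    (C : Type u) [Category.{v} C] [Preadditive C] [Linear A C] [HasColimits C] where
  /-- the functor `act^*` -/
  act : C ⥤ BaseChange C G.p₁
  additive : act.Additive
  linear : ∀ {X Y : C} (a : A) (h : X ⟶ Y), act.map (a • h) = G.p₂ a • act.map h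
  preservesColimits : PreservesColimits act
  /-- the unit constraint: an isomorphism of `1^* ∘ act^*` with the identity -/
  unitIso : act ⋙ pull G.unit ⋙ collapse G.unit_p₁ ⋙ BaseChange.forget C (RingHom.id A) ≅ 𝟭 C
  /-- the associativity constraint: an isomorphism of `mult^* ∘ act^*` with
  `(act^* × id) ∘ act^*` -/
  assocIso : act ⋙ pull G.mult ⋙ collapse G.mult_p₁ ≅ act ⋙ prodId act G.p₂ linear G.p₁

namespace GroupoidActionData

variable {A B : Type v} [CommRing A] [CommRing B] {G : AffineGroupoid A B}
  {C : Type u} [Category.{v} C] [Preadditive C] [Linear A C] [HasColimits C]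
  (α : GroupoidActionData G C)

/-- The map `act^*(X) ⟶ X` in `C` that corresponds to the unit constraint `1^*(act^*(X)) ≅ X`. -/
def ε (X : C) : (α.act.obj X).obj ⟶ X :=
  (BaseChange.toPull G.unit (α.act.obj X)).hom ≫ α.unitIso.hom.app X

/-- The map `act^*(X) ⟶ act^*(act^*(X))` in `C` that corresponds to the associativity constraint
`mult^*(act^*(X)) ≅ (act^* × id)(act^*(X))`. -/
def δ (X : C) : (α.act.obj X).obj ⟶ (α.act.obj (α.act.obj X).obj).obj :=
  (BaseChange.toPull G.mult (α.act.obj X)).hom ≫ (α.assocIso.hom.app X).hom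

end GroupoidActionData

/-- An action of the affine groupoid `𝒢 ⇉ S` on a category `C` over `S`: a functor `act^*` with
unit and associativity constraints that satisfy the usual compatibility conditions.

A morphism out of a pull-back `f^*(X)` is determined by its composition with the canonical map
`X ⟶ f^*(X)`. In this form the constraints are the maps `ε` and `δ`, and the compatibility
conditions (on `𝒢`, for the two restrictions of the associativity constraint to a unit, and on
`𝒢 ×_S 𝒢 ×_S 𝒢`, for the two ways to multiply three arrows) are the following equalities. -/
structure GroupoidAction {A B : Type v} [CommRing A] [CommRing B] (G : AffineGroupoid A B)
    (C : Type u) [Category.{v} C] [Preadditive C] [Linear A C] [HasColimits C]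
    extends GroupoidActionData G C where
  counit_left : ∀ X : C, toGroupoidActionData.δ X ≫ toGroupoidActionData.ε (act.obj X).obj = 𝟙 _
  counit_right : ∀ X : C,
    toGroupoidActionData.δ X ≫ (act.map (toGroupoidActionData.ε X)).hom = 𝟙 _
  coassoc : ∀ X : C, toGroupoidActionData.δ X ≫ toGroupoidActionData.δ (act.obj X).obj =
    toGroupoidActionData.δ X ≫ (act.map (toGroupoidActionData.δ X)).hom

end

/-! Tensoring with `act^*(X)` over `B` is a left adjoint, hence right exact, so in both parts only
injectivity of `F₁ ⊗_B act^*(X) → F₂ ⊗_B act^*(X)` is at stake. The action reduces it to injectivity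
of `F₁ ⊗_A X → F₂ ⊗_A X`, with `A` acting on modules through `p₂`.

The reduction (`mono_mapAct`) is an untwisting by inverse arrows. Write `T` for `act^*` followed by
forgetting the `B`-action, with counit `ε` and comultiplication `δ`. There are maps `s : T(M ⊗_B
act^*(X)) → M ⊗_A X`, natural in `M`, and `e : T(M ⊗_A X) → M ⊗_B act^*(X)` with `ε = e ∘ T(s) ∘ δ`,
an expression of `g g⁻¹ = 1` (`comult_untwist`). If `k` is killed by the map in question, naturality
of `s` gives `s ∘ T(k) = 0`, hence `k ∘ ε = 0`, hence `k = 0` since `ε` is an epimorphism. Left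
exactness of `act^*` is never needed.

Over `A`, injectivity is immediate when `X` is flat. When the quotient module is flat, it holds for
every colimit-preserving additive functor into a category with exact filtered colimits
(`mono_map_of_flat`): a pull-back along a free cover reduces to a free middle term `L`, and there
the submodule `K` is locally a retract of `L`, in the sense that each finitely generated `P ≤ K` is
fixed pointwise by some map `L → K`. -/

noncomputable section

/-! ### Colimits and faithfulness of the direct image -/

namespace BaseChange

variable {A R : Type v} [CommRing A] [CommRing R] {C : Type u} [Category.{v} C] [Preadditive C]
  [Linear A C] {f : A →+* R}

instance forget_preservesColimits [HasColimits C] : PreservesColimits (forget C f) where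
  preservesColimitsOfShape :=
    { preservesColimit := fun {F} =>
        preservesColimit_of_preserves_colimit_cocone (colimitIsColimit F)
          ((colimit.isColimit (F ⋙ forget C f)).ofIsoColimit
            (Cocone.ext (Iso.refl _) fun _ => Category.comp_id _)) }

instance : (forget C f).Faithful where
  map_injective h := hom_ext h

end BaseChange

/-! ### Universal properties of the tensor product by a module -/

namespace LinTensor

variable {R : Type v} [CommRing R] {E : Type u} [Category.{v} E] [Preadditive E] [Linear R E]
  [HasColimits E]

/-- Maps out of `M ⊗_R X` as an equivalence. -/
def descEquiv (M : Type v) [AddCommGroup M] [Module R M] (X Y : E) :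
    (tens R M X ⟶ Y) ≃ (M →ₗ[R] (X ⟶ Y)) where
  toFun h := (Linear.rightComp R X h).comp (mk X)
  invFun g := desc g
  left_inv h := hom_ext fun m => by simp
  right_inv g := LinearMap.ext fun m => by simp

/-- The functor `Y ↦ Hom(X, Y)` with values in `R`-modules. -/
@[simps]
def homFunctor (R : Type v) [CommRing R] [Linear R E] (X : E) : E ⥤ ModuleCat.{v} R where
  obj Y := ModuleCat.of R (X ⟶ Y)
  map h := ModuleCat.ofHom (Linear.rightComp R X h)
  map_id Y := by ext; simp
  map_comp g h := by ext; simp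

/-- The functor `M ↦ M ⊗_R X` is left adjoint to `Y ↦ Hom(X, Y)`. -/
def adjunction (R : Type v) [CommRing R] [Linear R E] (X : E) :
    functor R X ⊣ homFunctor R X :=
  Adjunction.mkOfHomEquiv
    { homEquiv := fun M Y => (descEquiv (M : Type v) X Y).trans
        (ModuleCat.homEquiv (M := M) (N := ModuleCat.of R (X ⟶ Y))).symm
      homEquiv_naturality_left_symm := fun {M N Y} g h => hom_ext fun m => by
        change mk X m ≫ desc _ = mk X m ≫ map g.hom (𝟙 X) ≫ desc _
        rw [mk_desc, ← Category.assoc, mk_map, Category.id_comp, mk_desc]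
        rfl
      homEquiv_naturality_right := fun {M Y Z} g h => by
        ext m
        exact (Category.assoc _ _ _).symm }

instance (X : E) : PreservesColimits (functor R X) :=
  (adjunction R X).leftAdjoint_preservesColimits

variable {D : Type*} [Category.{v} D] (L : E ⥤ D)
  {M : Type v} [AddCommGroup M] [Module R M]

theorem preserves_hom_ext [PreservesColimits L] {X : E} {W : D}
    {g h : L.obj (tens R M X) ⟶ W} (w : ∀ m : M, L.map (mk X m) ≫ g = L.map (mk X m) ≫ h) :
    g = h := by
  have : Epi (L.map (cokernel.π (relMap R M X))) := inferInstance
  refine (cancel_epi (L.map (cokernel.π (relMap R M X)))).1 ?_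
  refine Cofan.IsColimit.hom_ext (isColimitCofanMkObjOfIsColimit L _ _
    (coproductIsCoproduct fun _ : M => X)) _ _ fun m => ?_
  have := w m
  change L.map (Sigma.ι (fun _ : M => X) m ≫ cokernel.π (relMap R M X)) ≫ g =
    L.map (Sigma.ι (fun _ : M => X) m ≫ cokernel.π (relMap R M X)) ≫ h at this
  rw [L.map_comp] at this
  exact (Category.assoc _ _ _).symm.trans (this.trans (Category.assoc _ _ _))

/-- `M ⊗_R X` is a cokernel between coproducts of copies of `X`, and `L` preserves both, so its
universal property survives. No linearity of `L` is required: the scalar `r` acts through `L.map (r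
• 𝟙 X)`, which matters when `L` changes the base structure. -/
theorem exists_preserves_desc [Preadditive D] [L.Additive] [PreservesColimits L] {X : E} {W : D}
    (g : M →+ (L.obj X ⟶ W)) (hg : ∀ (r : R) (m : M), g (r • m) = L.map (r • 𝟙 X) ≫ g m) :
    ∃ h : L.obj (tens R M X) ⟶ W, ∀ m : M, L.map (mk X m) ≫ h = g m := by
  let hM := isColimitCofanMkObjOfIsColimit L _ _ (coproductIsCoproduct fun _ : M => X)
  let k : L.obj (∐ fun _ : M => X) ⟶ W := Cofan.IsColimit.desc hM fun m => g m
  have hk (m : M) : L.map (Sigma.ι (fun _ : M => X) m) ≫ k = g m := Cofan.IsColimit.fac hM _ m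
  have hk0 : L.map (relMap R M X) ≫ k = 0 := by
    refine Cofan.IsColimit.hom_ext (isColimitCofanMkObjOfIsColimit L _ _
      (coproductIsCoproduct fun _ : Rel R M => X)) _ _ fun r => ?_
    have h1 : Sigma.ι (fun _ : Rel R M => X) r ≫ relMap R M X =
        r.1.sum fun m c => c • Sigma.ι (fun _ : M => X) m := by rw [relMap, Sigma.ι_desc]
    have h2 := congrArg g r.2
    rw [Finsupp.linearCombination_apply, Finsupp.sum, map_sum, map_zero] at h2
    change L.map (Sigma.ι (fun _ : Rel R M => X) r) ≫ _ =
      L.map (Sigma.ι (fun _ : Rel R M => X) r) ≫ _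
    rw [comp_zero, ← Category.assoc, ← L.map_comp, h1, Finsupp.sum, L.map_sum,
      Preadditive.sum_comp, ← h2]
    refine Finset.sum_congr rfl fun m _ => ?_
    rw [hg, id, ← hk, ← Category.assoc, ← L.map_comp, Linear.smul_comp, Category.id_comp]
  let hc := isColimitOfHasCokernelOfPreservesColimit L (relMap R M X)
  refine ⟨hc.desc (CokernelCofork.ofπ k hk0), fun m => ?_⟩
  rw [← hk m]
  change L.map (Sigma.ι (fun _ : M => X) m ≫ cokernel.π (relMap R M X)) ≫ _ = _
  rw [L.map_comp, Category.assoc]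
  exact congrArg _ (hc.fac (CokernelCofork.ofπ k hk0) WalkingParallelPair.one)

end LinTensor

/-! ### Short exact sequences in a base-changed category -/

namespace BaseChange

variable {A R : Type v} [CommRing A] [CommRing R] {C : Type u} [Category.{v} C] [Abelian C]
  [Linear A C] [HasColimits C] {f : A →+* R}

instance : HasZeroObject (BaseChange C f) :=
  hasZeroObject_of_hasInitial_object

/-- A right exact sequence in a base-changed category is short exact if its first map is a
monomorphism of underlying objects. -/
theorem shortExact_of_isColimit (S : ShortComplex (BaseChange C f))
    (hS : IsColimit (CokernelCofork.ofπ S.g S.zero)) (hf : Mono S.f.hom) : S.ShortExact := by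
  let S' : ShortComplex C := S.map (forget C f)
  have hS' : IsColimit (CokernelCofork.ofπ S'.g S'.zero) :=
    CokernelCofork.mapIsColimit _ hS (forget C f)
  have hf' : Mono S'.f := hf
  have hk : IsLimit (KernelFork.ofι S'.f S'.zero) :=
    (S'.exact_of_g_is_cokernel hS').fIsKernel
  have lift {W : C} (k : W ⟶ S.X₂.obj) (hk0 : k ≫ S.g.hom = 0) :
      ∃ l : W ⟶ S.X₁.obj, l ≫ S.f.hom = k :=
    ⟨hk.lift (KernelFork.ofι (f := S'.g) k hk0), Fork.IsLimit.lift_ι hk⟩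
  have lift' {W : BaseChange C f} (k : W ⟶ S.X₂) (hk0 : k ≫ S.g = 0) :
      ∃ l : W ⟶ S.X₁, l ≫ S.f = k := by
    obtain ⟨l, hl⟩ := lift k.hom (congrArg Hom.hom hk0)
    -- The lift found in `C` commutes with `R` because it does so after the monomorphism `S.f.hom`.
    refine ⟨⟨l, fun r => ?_⟩, hom_ext hl⟩
    rw [← cancel_mono S.f.hom, Category.assoc, Category.assoc, hl, S.f.comm, k.comm,
      ← Category.assoc, hl]
  have : Mono S.f := (forget C f).mono_of_mono_map hf
  have hk' : IsLimit (KernelFork.ofι S.f S.zero) :=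
    KernelFork.IsLimit.ofι' _ _ fun k hk0 => ⟨(lift' k hk0).choose, (lift' k hk0).choose_spec⟩
  have : Epi S.g := Cofork.IsColimit.epi hS
  -- The base-changed category carries no abelian structure here, so the homology data are built by
  -- hand: the first map is a kernel, the second a cokernel, and the homology is a zero object.
  have : S.HasHomology := by
    obtain ⟨Z, hZ⟩ := HasZeroObject.zero (C := BaseChange C f)
    let l : S.LeftHomologyData :=
      { K := S.X₁
        H := Z
        i := S.f
        π := 0
        wi := S.zero
        hi := hk'
        wπ := comp_zero
        hπ := CokernelCofork.IsColimit.ofπ _ _ (fun _ _ => 0)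
          (fun k hk0 => by
            have e : hk'.lift (KernelFork.ofι S.f S.zero) = 𝟙 _ :=
              Fork.IsLimit.hom_ext hk' ((Fork.IsLimit.lift_ι hk').trans (Category.id_comp _).symm)
            rw [e] at hk0
            rw [comp_zero, ← hk0]; exact Category.id_comp _)
          (fun _ _ _ _ => hZ.eq_of_src _ _) }
    let r : S.RightHomologyData :=
      { Q := S.X₃
        H := Z
        p := S.g
        ι := 0
        wp := S.zero
        hp := hS
        wι := zero_comp
        hι := KernelFork.IsLimit.ofι _ _ (fun _ _ => 0)
          (fun k hk0 => by
            have e : hS.desc (CokernelCofork.ofπ S.g S.zero) = 𝟙 _ :=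
              Cofork.IsColimit.hom_ext hS
                ((Cofork.IsColimit.π_desc hS).trans (Category.comp_id _).symm)
            rw [e] at hk0
            rw [zero_comp, ← hk0]; exact Category.comp_id _)
          (fun _ _ _ _ => hZ.eq_of_tgt _ _) }
    exact ⟨⟨{ left := l, right := r, iso := Iso.refl _,
              comm := (zero_comp).trans (S.zero).symm }⟩⟩
  exact .mk' (S.exact_of_f_is_kernel hk') inferInstance inferInstance

end BaseChange

/-! ### Functors applied to sequences with flat quotient -/

/-- If `L` is free and `L / K` is flat, then every finitely generated submodule of `K` is fixed
pointwise by some linear map `L → K`. -/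
theorem Module.Flat.exists_retraction_of_fg {A L N : Type*} [CommRing A] [AddCommGroup L]
    [Module A L] [Module.Free A L] [AddCommGroup N] [Module A N] [Module.Flat A N]
    (π : L →ₗ[A] N) (hπ : Function.Surjective π) (P : Submodule A L) (hP : P.FG)
    (hPπ : P ≤ LinearMap.ker π) :
    ∃ φ : L →ₗ[A] L, (∀ x, π (φ x) = 0) ∧ ∀ x ∈ P, φ x = x := by
  classical
  let b := Module.Free.chooseBasis A L
  obtain ⟨t, ht⟩ := hP
  -- Only finitely many basis vectors occur in the generators of `P`; `p` projects to their span and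
  -- `i` includes it back, so `i ∘ p` fixes `P`.
  let s : Finset (Module.Free.ChooseBasisIndex A L) := t.biUnion fun x => (b.repr x).support
  let p : L →ₗ[A] (s →₀ A) := (Finsupp.lcomapDomain (Subtype.val : s → _)
    Subtype.val_injective).comp b.repr.toLinearMap
  let i : (s →₀ A) →ₗ[A] L := b.repr.symm.toLinearMap.comp (Finsupp.lmapDomain A A Subtype.val)
  have hip : ∀ x ∈ P, i (p x) = x := by
    have : P ≤ LinearMap.eqLocus (i.comp p) LinearMap.id := by
      rw [← ht, Submodule.span_le]
      intro x hx
      change b.repr.symm (Finsupp.mapDomain Subtype.val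
        (Finsupp.comapDomain Subtype.val (b.repr x) _)) = x
      rw [LinearEquiv.symm_apply_eq, Finsupp.mapDomain_comapDomain _ Subtype.val_injective]
      intro j hj
      exact ⟨⟨j, Finset.mem_biUnion.2 ⟨x, hx, hj⟩⟩, rfl⟩
    exact fun x hx => this hx
  have : Module.Finite A P := .of_fg ⟨t, ht⟩
  -- Equational criterion for flatness: `π ∘ i` kills `p(P)`, so it factors as `y ∘ a` through a
  -- finite free module with `a` already zero on `p(P)`. With a lift `z` of `y` to `L`, subtracting
  -- `z ∘ a` from `i` makes the image fall into the kernel of `π` without moving `P`.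
  obtain ⟨k, a, y, hy, ha⟩ := Module.Flat.exists_factorization_of_comp_eq_zero_of_free
    (f := p.comp P.subtype) (x := π.comp i) (LinearMap.ext fun x => by
      change π (i (p x)) = 0
      rw [hip x x.2]; exact hPπ x.2)
  obtain ⟨z, hz⟩ := Module.projective_lifting_property π y hπ
  refine ⟨(i - z.comp a).comp p, fun x => ?_, fun x hx => ?_⟩
  · have h1 := LinearMap.congr_fun hy (p x)
    have h2 := LinearMap.congr_fun hz (a (p x))
    simp only [LinearMap.comp_apply] at h1 h2
    simp [h1, h2]
  · have h1 : a (p x) = 0 := LinearMap.congr_fun ha ⟨x, hx⟩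
    simp [h1, hip x hx]

/-- In an abelian category, a pull-back square of an epimorphism is a push-out square. -/
theorem CategoryTheory.IsPullback.isPushout_of_epi {C : Type*} [Category* C] [Abelian C]
    {X₁ X₂ X₃ X₄ : C} {t : X₁ ⟶ X₂} {l : X₁ ⟶ X₃} {r : X₂ ⟶ X₄} {b : X₃ ⟶ X₄}
    (h : IsPullback t l r b) [Epi b] : IsPushout t l r b := by
  have : Epi t := (MorphismProperty.epimorphisms C).of_isPullback h.flip inferInstance
  -- The pair of `0` and the inclusion of `ker b` lifts to the pull-back, so `h₂` kills `ker b` and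
  -- descends along `b`.
  have hk {W : C} (h₁ : X₂ ⟶ W) (h₂ : X₃ ⟶ W) (w : t ≫ h₁ = l ≫ h₂) : kernel.ι b ≫ h₂ = 0 := by
    have e := h.lift_snd 0 (kernel.ι b) (by simp)
    rw [← e, Category.assoc, ← w, h.lift_fst_assoc, zero_comp]
  refine ⟨⟨h.w⟩, ⟨PushoutCocone.IsColimit.mk _
    (fun s => Abelian.epiDesc b s.inr (hk _ _ s.condition)) (fun s => ?_)
    (fun s => Abelian.comp_epiDesc _ _ _)
    (fun s m _ hm => (cancel_epi b).1 (hm.trans (Abelian.comp_epiDesc _ _ _).symm))⟩⟩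
  rw [← cancel_epi t, h.w_assoc, Abelian.comp_epiDesc, s.condition]

namespace ModuleCat

variable {A : Type v} [CommRing A]

/-- The directed system of quotients of a module by its finitely generated submodules. -/
@[simps]
def fgQuotients (K : Type v) [AddCommGroup K] [Module A K] :
    {P : Submodule A K // P.FG} ⥤ ModuleCat.{v} A where
  obj P := ModuleCat.of A (K ⧸ P.1)
  map {P Q} h := ModuleCat.ofHom (Submodule.factor (leOfHom h))
  map_id P := by ext x; rfl
  map_comp {P Q S} g h := by ext x; rfl

/-- The class of `x` dies at the later stage `P ⊔ span {x}`; in other words, the colimit of the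
system is zero. -/
theorem fgQuotients_hom_ext (K : Type v) [AddCommGroup K] [Module A K]
    (c : Cocone (fgQuotients (A := A) K)) (P : {P : Submodule A K // P.FG}) : c.ι.app P = 0 := by
  ext x
  obtain ⟨x, rfl⟩ := Submodule.mkQ_surjective _ x
  let Q : {P : Submodule A K // P.FG} :=
    ⟨P.1 ⊔ Submodule.span A {x}, P.2.sup (Submodule.fg_span_singleton x)⟩
  have hPQ : P ≤ Q := le_sup_left (a := P.1)
  rw [← c.w (homOfLE hPQ)]
  change (c.ι.app Q).hom (Submodule.factor hPQ (P.1.mkQ x)) = 0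
  have : Submodule.factor hPQ (P.1.mkQ x) = 0 :=
    (Submodule.Quotient.mk_eq_zero _).2
      ((le_sup_right (a := P.1)) (Submodule.mem_span_singleton_self x))
  rw [this]; exact map_zero (c.ι.app Q).hom

instance (K : Type v) [AddCommGroup K] [Module A K] :
    IsFiltered {P : Submodule A K // P.FG} := by
  have : Nonempty {P : Submodule A K // P.FG} := ⟨⊥, Submodule.fg_bot⟩
  have : IsDirectedOrder {P : Submodule A K // P.FG} :=
    ⟨fun P Q => ⟨⟨P.1 ⊔ Q.1, P.2.sup Q.2⟩, le_sup_left (a := P.1), le_sup_right (a := P.1)⟩⟩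
  infer_instance

variable {C : Type u} [Category.{v} C] [Abelian C] [HasColimits C] [AB5 C]
  (F : ModuleCat.{v} A ⥤ C) [F.Additive] [PreservesColimits F]

/-- A colimit preserving functor to an abelian category with exact filtered colimits sends
a short exact sequence `0 → K → L → N → 0` with `L` free and `N` flat to a sequence that is
exact on the left. -/
theorem mono_map_of_free {K L N : ModuleCat.{v} A} (f : K ⟶ L) (g : L ⟶ N)
    [Module.Free A L] [Module.Flat A N] (hf : Function.Injective f)
    (hg : Function.Surjective g) (hfg : ∀ x, g x = 0 ↔ ∃ y, f y = x) : Mono (F.map f) := by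
  refine Preadditive.mono_of_kernel_zero ?_
  let k := kernel.ι (F.map f)
  let J := {P : Submodule A K // P.FG}
  let t : (Functor.const J).obj (kernel (F.map f)) ⟶ fgQuotients (A := A) K ⋙ F :=
    { app := fun P => k ≫ F.map (ModuleCat.ofHom P.1.mkQ)
      naturality := fun P Q h => by
        change 𝟙 _ ≫ _ = (k ≫ F.map _) ≫ F.map _
        rw [Category.id_comp, Category.assoc]
        exact congrArg (k ≫ ·) (F.map_comp (ModuleCat.ofHom P.1.mkQ)
          ((fgQuotients (A := A) K).map h)) }
  have ht (P : J) : Mono (t.app P) := by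
    obtain ⟨φ, h1, h2⟩ := Module.Flat.exists_retraction_of_fg g.hom hg (P.1.map f.hom)
      (P.2.map _) (by
        rintro _ ⟨x, -, rfl⟩
        exact (hfg _).2 ⟨x, rfl⟩)
    let e : K ≃ₗ[A] LinearMap.range f.hom := LinearEquiv.ofInjective f.hom hf
    let ψ : L →ₗ[A] K := e.symm.toLinearMap.comp (φ.codRestrict _ fun x => (hfg _).1 (h1 x))
    have hψ (x : L) : f (ψ x) = φ x :=
      congrArg Subtype.val (e.apply_symm_apply ⟨φ x, (hfg _).1 (h1 x)⟩)
    -- `ψ ∘ f` is the identity on `P`, so its difference from the identity of `K` factors through `K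
    -- ⧸ P`.
    let χ : (K ⧸ P.1) →ₗ[A] K := P.1.liftQ (LinearMap.id - ψ.comp f.hom) fun x hx => by
      refine sub_eq_zero.2 (hf ?_)
      refine Eq.symm ((hψ _).trans (h2 _ ⟨x, hx, rfl⟩))
    have e1 : 𝟙 K = f ≫ ModuleCat.ofHom ψ +
        ModuleCat.ofHom P.1.mkQ ≫ ModuleCat.ofHom χ := by
      ext x
      change x = ψ (f x) + (x - ψ (f x))
      abel
    -- On the kernel of `F.map f` the summand of the identity that passes through `f` vanishes, so
    -- the inclusion of the kernel factors through `F(K ⧸ P)`.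
    have e2 : k = t.app P ≫ F.map (ModuleCat.ofHom χ) := by
      have := k ≫= congrArg F.map e1
      rw [F.map_id, Category.comp_id, F.map_add, F.map_comp, F.map_comp, Preadditive.comp_add,
        kernel.condition_assoc, zero_comp, zero_add] at this
      exact this.trans (Category.assoc _ _ _).symm
    have : Mono (t.app P ≫ F.map (ModuleCat.ofHom χ)) := e2 ▸ inferInstance
    exact mono_of_mono _ (F.map (ModuleCat.ofHom χ))
  have ht' : Mono t := NatTrans.mono_of_mono_app t
  -- Exactness of filtered colimits enters here: the kernel embeds into the colimit of the `F(K ⧸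
  -- P)`, whose legs are all zero.
  have hc : Mono (colimMap t) := inferInstanceAs (Mono (colim.map t))
  have hz (P : J) : colimit.ι (fgQuotients (A := A) K ⋙ F) P = 0 := by
    let c := colimit.cocone (fgQuotients (A := A) K)
    have := (isColimitOfPreserves F (colimit.isColimit (fgQuotients (A := A) K)))
    refine (cancel_mono (this.coconePointUniqueUpToIso (colimit.isColimit _)).inv).1 ?_
    rw [zero_comp]
    refine (IsColimit.comp_coconePointUniqueUpToIso_inv _ _ _).trans ?_
    change F.map (c.ι.app P) = 0
    rw [fgQuotients_hom_ext, F.map_zero]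
  have P : J := ⟨⊥, Submodule.fg_bot⟩
  have h0 : colimit.ι ((Functor.const J).obj (kernel (F.map f))) P = 0 := by
    rw [← cancel_mono (colimMap t), ι_colimMap, hz, comp_zero, zero_comp]
  let c0 : Cocone ((Functor.const J).obj (kernel (F.map f))) := { pt := _, ι := 𝟙 _ }
  have h1 : colimit.ι ((Functor.const J).obj (kernel (F.map f))) P ≫ colimit.desc _ c0 = 𝟙 _ :=
    colimit.ι_desc _ _
  rw [h0, zero_comp] at h1
  change k = 0
  rw [← Category.id_comp k]
  exact (congrArg (· ≫ k) h1.symm).trans zero_comp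

/-- A colimit preserving functor to an abelian category with exact filtered colimits sends
a short exact sequence with flat quotient to a sequence that is exact on the left. -/
theorem mono_map_of_flat {S : ShortComplex (ModuleCat.{v} A)} (hS : S.ShortExact)
    [Module.Flat A S.X₃] : Mono (F.map S.f) := by
  have hf : Function.Injective S.f := hS.moduleCat_injective_f
  have hg : Function.Surjective S.g := hS.moduleCat_surjective_g
  let L : ModuleCat.{v} A := ModuleCat.of A (S.X₂ →₀ A)
  let p : L ⟶ S.X₂ := ModuleCat.ofHom (Finsupp.linearCombination A id)
  have hp : Function.Surjective p := Finsupp.linearCombination_id_surjective A _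
  have : Epi p := (ModuleCat.epi_iff_surjective p).2 hp
  -- The pull-back of `S.f` along the free cover `p` is the kernel of `L → S.X₃`, to which the free
  -- case applies. The square is also a push-out, `F` preserves it, and monomorphisms of an abelian
  -- category are stable under push-out.
  have hpb := IsPullback.of_hasPullback S.f p
  have hpo : IsPushout (pullback.fst S.f p) (pullback.snd S.f p) S.f p := hpb.isPushout_of_epi
  have : Mono (F.map (pullback.snd S.f p)) := by
    have : Module.Free A L := inferInstanceAs (Module.Free A (S.X₂ →₀ A))
    refine mono_map_of_free F (pullback.snd S.f p) (p ≫ S.g) ?_ (hg.comp hp) fun x => ?_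
    · have : Mono S.f := hS.mono_f
      exact (ModuleCat.mono_iff_injective _).1 inferInstance
    · change S.g (p x) = 0 ↔ _
      have hex : S.g (p x) = 0 ↔ ∃ y, S.f y = p x :=
        (ShortComplex.ShortExact.moduleCat_exact_iff_function_exact S).1 hS.exact (p x)
      rw [hex]
      refine ⟨fun ⟨y, hy⟩ => ?_, fun ⟨y, hy⟩ => ⟨pullback.fst S.f p y, ?_⟩⟩
      -- An element of the categorical pull-back is obtained as a map out of `A` evaluated at `1`.
      · let y' : ModuleCat.of A A ⟶ S.X₁ := ModuleCat.ofHom (LinearMap.toSpanSingleton A _ y)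
        let x' : ModuleCat.of A A ⟶ L := ModuleCat.ofHom (LinearMap.toSpanSingleton A _ x)
        have w : y' ≫ S.f = x' ≫ p := by
          ext
          change S.f ((1 : A) • y) = p ((1 : A) • x)
          rw [one_smul, one_smul, hy]
        refine ⟨pullback.lift y' x' w (1 : A), ?_⟩
        have e := congrArg (fun h : ModuleCat.of A A ⟶ L => h (1 : A)) (pullback.lift_snd y' x' w)
        exact e.trans (one_smul A x)
      · rw [← hy]
        exact congrArg (fun h : pullback S.f p ⟶ S.X₂ => h y) pullback.condition
  exact (MorphismProperty.monomorphisms C).of_isPushout (hpo.map F) this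

end ModuleCat

/-! ### The canonical map to a pull-back -/

namespace BaseChange

variable {A R : Type v} [CommRing A] [CommRing R] {E : Type u} [Category.{v} E] [Preadditive E]
  [Linear A E] [HasColimits E] (f : A →+* R)

theorem toPull_naturality {X Y : E} (h : X ⟶ Y) :
    toPull f X ≫ ((pull f).map h).hom = h ≫ toPull f Y :=
  LinTensor.mk_map _ _ _

theorem toPull_act (X : E) (r : R) :
    toPull f X ≫ (((pull f).obj X).act r).asHom = LinTensor.mk X (M := AlgOf f) r := by
  refine (LinTensor.mk_map _ _ _).trans ((Category.id_comp _).trans ?_)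
  exact congrArg _ (mul_one (M := R) r)

theorem smul_toPull (X : E) (a : A) :
    a • toPull f X = toPull f X ≫ (((pull f).obj X).act (f a)).asHom := by
  rw [toPull_act]
  refine (map_smul (LinTensor.mk X (M := AlgOf f)) a 1).symm.trans ?_
  exact congrArg _ (mul_one (M := R) (f a))

theorem act_asHom_mul {C : Type u} [Category.{v} C] [Preadditive C] [Linear A C]
    (X : BaseChange C f) (r s : R) :
    (X.act (r * s)).asHom = (X.act s).asHom ≫ (X.act r).asHom := by
  rw [map_mul]; rfl

end BaseChange

/-! ### The endofunctor of an action, its counit and its comultiplication -/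

namespace GroupoidActionData

open BaseChange GroupoidAction

variable {A B : Type v} [CommRing A] [CommRing B] {G : AffineGroupoid A B}
  {C : Type u} [Category.{v} C] [Preadditive C] [Linear A C] [HasColimits C]
  (α : GroupoidActionData G C)

instance : α.act.Additive := α.additive

instance : PreservesColimits α.act := α.preservesColimits

/-- The functor `act^*` followed by the direct image. -/
def total : C ⥤ C := α.act ⋙ forget C G.p₁

instance : α.total.Additive := inferInstanceAs (α.act ⋙ forget C G.p₁).Additive

instance : PreservesColimits α.total :=
  inferInstanceAs (PreservesColimits (α.act ⋙ forget C G.p₁))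

/-- The map `ε` as a morphism from `total`. -/
def counit (X : C) : α.total.obj X ⟶ X := α.ε X

/-- The map `δ` as a morphism between iterates of `total`. -/
def comult (X : C) : α.total.obj X ⟶ α.total.obj (α.total.obj X) := α.δ X

/-- The action of `b : B` on `act^*(X)`. -/
def scalar (X : C) (b : B) : α.total.obj X ⟶ α.total.obj X :=
  ((α.act.obj X).act b).asHom

theorem scalar_comp {X Y : C} (b : B) (h : X ⟶ Y) :
    α.scalar X b ≫ α.total.map h = α.total.map h ≫ α.scalar Y b :=
  (α.act.map h).comm b

theorem scalar_algebra (X : C) (a : A) : α.scalar X (G.p₁ a) = a • 𝟙 _ :=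
  (α.act.obj X).act_algebra a

theorem scalar_mul (X : C) (b c : B) :
    α.scalar X (b * c) = α.scalar X c ≫ α.scalar X b :=
  act_asHom_mul _ _ b c

/-- Functoriality in `X` makes `a` act through `p₂`, whereas `a` itself acts on `act^*(X)` through
`p₁`; thus `total` need not be `A`-linear. -/
theorem total_map_smul (X : C) (a : A) :
    α.total.map (a • 𝟙 X) = α.scalar X (G.p₂ a) := by
  have h : α.act.map (a • 𝟙 X) = G.p₂ a • 𝟙 _ := by rw [α.linear, α.act.map_id]
  exact (congrArg Hom.hom h).trans (Category.comp_id _)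

theorem counit_naturality {X Y : C} (h : X ⟶ Y) :
    α.total.map h ≫ α.counit Y = α.counit X ≫ h := by
  have h1 := congrArg Hom.hom (toPull_naturality G.unit (α.act.map h))
  have h2 := α.unitIso.hom.naturality h
  refine (Category.assoc _ _ _).symm.trans ?_
  refine (congrArg (· ≫ α.unitIso.hom.app Y) h1.symm).trans ?_
  refine (Category.assoc _ _ _).trans ?_
  exact (congrArg ((toPull G.unit (α.act.obj X)).hom ≫ ·) h2).trans (Category.assoc _ _ _).symm

theorem scalar_counit (X : C) (b : B) :
    α.scalar X b ≫ α.counit X = G.unit b • α.counit X := by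
  have h1 := congrArg Hom.hom (smul_toPull G.unit (α.act.obj X) b)
  have h2 := ((collapse G.unit_p₁).obj ((pull G.unit).obj (α.act.obj X))).act_algebra (G.unit b)
  refine (Category.assoc _ _ _).symm.trans ?_
  refine (congrArg (· ≫ α.unitIso.hom.app X) h1).trans ?_
  refine (congrArg (fun k => ((toPull G.unit (α.act.obj X)).hom ≫ k) ≫ α.unitIso.hom.app X)
    h2).trans ?_
  refine (congrArg (· ≫ α.unitIso.hom.app X) (Linear.comp_smul _ _ _ _ _ _)).trans ?_
  refine (Linear.smul_comp _ _ _ _ _ _).trans ?_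
  exact congrArg (fun k => G.unit b • (k ≫ α.unitIso.hom.app X)) (Category.comp_id _)

/-- The unit homomorphism `B → A` is split by `p₁`, so `a ⊗ x = p₁(a) • (1 ⊗ x)` and the canonical
map to `1^*(act^*(X))` is an epimorphism. The direct image preserves it, and the unit constraint is
an isomorphism. -/
instance (X : C) : Epi (α.counit X) := by
  have h : Epi (toPull G.unit (α.act.obj X)) := by
    refine ⟨fun g h w => LinTensor.hom_ext fun a => ?_⟩
    have ha : LinTensor.mk (α.act.obj X) (M := AlgOf G.unit) a =
        HSMul.hSMul (α := B) (G.p₁ (a : A)) (toPull G.unit (α.act.obj X)) := by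
      rw [smul_toPull, toPull_act]
      exact congrArg _ (RingHom.congr_fun G.unit_p₁ a).symm
    rw [ha]
    refine (Linear.smul_comp (R := B) _ _ _ _ _ _).trans (Eq.trans ?_
      (Linear.smul_comp (R := B) _ _ _ _ _ _).symm)
    exact congrArg (HSMul.hSMul (α := B) (G.p₁ (a : A))) w
  have h' : Epi (toPull G.unit (α.act.obj X)).hom :=
    inferInstanceAs (Epi ((forget C G.p₁).map (toPull G.unit (α.act.obj X))))
  have h'' : Epi (α.unitIso.app X).hom := inferInstance
  exact epi_comp' h' h''

theorem comult_naturality {X Y : C} (h : X ⟶ Y) :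
    α.total.map h ≫ α.comult Y = α.comult X ≫ α.total.map (α.total.map h) := by
  have h1 := congrArg Hom.hom (toPull_naturality G.mult (α.act.map h))
  have h2 := congrArg Hom.hom (α.assocIso.hom.naturality h)
  refine (Category.assoc _ _ _).symm.trans ?_
  refine (congrArg (· ≫ (α.assocIso.hom.app Y).hom) h1.symm).trans ?_
  refine (Category.assoc _ _ _).trans ?_
  exact (congrArg ((toPull G.mult (α.act.obj X)).hom ≫ ·) h2).trans (Category.assoc _ _ _).symm

/-- The action of `B ⊗_A B` on `act^*(act^*(X))`. -/
def scalar₂ (X : C) : Fib G.p₂ G.p₁ →+ (α.total.obj (α.total.obj X) ⟶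
    α.total.obj (α.total.obj X)) where
  toFun r := (prodAct α.act G.p₂ α.linear G.p₁ (α.act.obj X) r).asHom.hom
  map_zero' := congrArg (fun k : End (α.act.obj (α.act.obj X).obj) => k.asHom.hom) (map_zero _)
  map_add' r s :=
    congrArg (fun k : End (α.act.obj (α.act.obj X).obj) => k.asHom.hom) (map_add _ r s)

theorem scalar₂_tmul (X : C) (b c : B) :
    α.scalar₂ X ((b : AlgOf G.p₂) ⊗ₜ[A] (c : AlgOf G.p₁)) =
      α.scalar _ b ≫ α.total.map (α.scalar X c) :=
  congrArg Hom.hom (prodAct_tmul α.act G.p₂ α.linear G.p₁ (α.act.obj X) b c)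

/-- The object underlying `mult^*(act^*(X))`. -/
def multPull (X : C) : C := (LinTensor.tens B (AlgOf G.mult) (α.act.obj X)).obj

/-- The map `act^*(X) ⟶ mult^*(act^*(X))`, `x ↦ r ⊗ x`. -/
def multMk (X : C) (r : Fib G.p₂ G.p₁) : α.total.obj X ⟶ α.multPull X :=
  (LinTensor.mk (α.act.obj X) (M := AlgOf G.mult) r).hom

/-- The associativity constraint on underlying objects. -/
def assoc (X : C) : α.multPull X ≅ α.total.obj (α.total.obj X) where
  hom := (α.assocIso.hom.app X).hom
  inv := (α.assocIso.inv.app X).hom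
  hom_inv_id := congrArg Hom.hom (α.assocIso.hom_inv_id_app X)
  inv_hom_id := congrArg Hom.hom (α.assocIso.inv_hom_id_app X)

/-- The associativity constraint is linear over `B ⊗_A B` and sends `1 ⊗ x` to `δ(x)`, so it sends
`r ⊗ x` to `r δ(x)`. -/
theorem multMk_assoc (X : C) (r : Fib G.p₂ G.p₁) :
    α.multMk X r ≫ (α.assoc X).hom = α.comult X ≫ α.scalar₂ X r := by
  have h1 := congrArg Hom.hom (toPull_act G.mult (α.act.obj X) r)
  have h2 := (α.assocIso.hom.app X).comm r
  refine (congrArg (· ≫ (α.assocIso.hom.app X).hom) h1.symm).trans ?_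
  refine (Category.assoc _ _ _).trans ?_
  exact (congrArg ((toPull G.mult (α.act.obj X)).hom ≫ ·) h2).trans (Category.assoc _ _ _).symm

theorem multPull_hom_ext {X W : C} {s t : α.multPull X ⟶ W}
    (w : ∀ r, α.multMk X r ≫ s = α.multMk X r ≫ t) : s = t :=
  LinTensor.preserves_hom_ext (forget C G.p₁) (R := B) (M := AlgOf G.mult) w

theorem scalar_comult (X : C) (b : B) :
    α.scalar X b ≫ α.comult X = α.comult X ≫ α.scalar₂ X (G.mult b) := by
  have h1 := congrArg Hom.hom ((smul_toPull G.mult (α.act.obj X) b).trans (toPull_act _ _ _))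
  rw [← multMk_assoc]
  exact (Category.assoc _ _ _).symm.trans (congrArg (· ≫ (α.assocIso.hom.app X).hom) h1)

/-- Through the associativity isomorphism with `mult^*(act^*(X))`, the object `act^*(act^*(X))` is
generated over `B ⊗_A B` by the elements `δ(x)`. -/
theorem comult_hom_ext {X W : C} {s t : α.total.obj (α.total.obj X) ⟶ W}
    (w : ∀ b c : B, α.comult X ≫ α.scalar _ b ≫ α.total.map (α.scalar X c) ≫ s =
      α.comult X ≫ α.scalar _ b ≫ α.total.map (α.scalar X c) ≫ t) : s = t := by
  have w' (r : Fib G.p₂ G.p₁) : α.comult X ≫ α.scalar₂ X r ≫ s =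
      α.comult X ≫ α.scalar₂ X r ≫ t := by
    induction r using TensorProduct.induction_on with
    | zero => rw [map_zero, zero_comp, zero_comp]
    | tmul b c =>
      have := w b c
      rw [← Category.assoc (α.scalar _ b), ← Category.assoc (α.scalar _ b)] at this
      rw [α.scalar₂_tmul X b c]
      exact this
    | add x y hx hy =>
      rw [map_add, Preadditive.add_comp, Preadditive.add_comp, Preadditive.comp_add,
        Preadditive.comp_add, hx, hy]
  refine (cancel_epi (α.assoc X).hom).1 (α.multPull_hom_ext fun r => ?_)
  rw [← Category.assoc, ← Category.assoc, multMk_assoc, Category.assoc, Category.assoc, w']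

/-- The existence half of the same principle: the only relations among the `r δ(x)` are additivity
and `mult(b) r δ(x) = r δ(b x)`. -/
theorem exists_comult_desc {X W : C} (g : Fib G.p₂ G.p₁ →+ (α.total.obj X ⟶ W))
    (hg : ∀ b r, g (G.mult b * r) = α.scalar X b ≫ g r) :
    ∃ s : α.total.obj (α.total.obj X) ⟶ W, ∀ b c : B,
      α.comult X ≫ α.scalar _ b ≫ α.total.map (α.scalar X c) ≫ s =
        g ((b : AlgOf G.p₂) ⊗ₜ[A] (c : AlgOf G.p₁)) := by
  obtain ⟨s, hs⟩ : ∃ s : α.multPull X ⟶ W, ∀ r, α.multMk X r ≫ s = g r :=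
    LinTensor.exists_preserves_desc (forget C G.p₁) (R := B) (M := AlgOf G.mult)
      (X := α.act.obj X) g fun b r => (hg b r).trans
        (congrArg (· ≫ g r) (Category.comp_id (α.scalar X b)).symm)
  refine ⟨(α.assoc X).inv ≫ s, fun b c => ?_⟩
  rw [← hs, ← Category.assoc (α.scalar _ b), ← α.scalar₂_tmul X b c, ← Category.assoc,
    ← α.multMk_assoc, Category.assoc, Iso.hom_inv_id_assoc]

end GroupoidActionData

/-! ### Tensor products over the base of modules restricted from `B` -/

namespace LinTensor

variable {A B : Type v} [CommRing A] [CommRing B] (f : A →+* B)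
  {C : Type u} [Category.{v} C] [Preadditive C] [Linear A C] [HasColimits C]
  (X : C) (M : ModuleCat.{v} B) {N : ModuleCat.{v} B}

/-- The tensor product `M ⊗_A X`, for the `A`-module underlying a `B`-module `M`. -/
def tensRes : C := tens A ((ModuleCat.restrictScalars f).obj M) X

variable {M}

/-- The map `X ⟶ M ⊗_A X`, `x ↦ m ⊗ x`. -/
def mkRes : M →+ (X ⟶ tensRes f X M) :=
  (mk (R := A) (M := (ModuleCat.restrictScalars f).obj M) X).toAddMonoidHom

/-- The functoriality of `M ⊗_A X` in `M`. -/
def mapRes (i : M ⟶ N) : tensRes f X M ⟶ tensRes f X N :=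
  (functor A X).map ((ModuleCat.restrictScalars f).map i)

theorem mkRes_mapRes (i : M ⟶ N) (m : M) : mkRes f X m ≫ mapRes f X i = mkRes f X (i m) :=
  (mk_map ((ModuleCat.restrictScalars f).map i).hom (𝟙 X) m).trans (Category.id_comp _)

theorem mkRes_smul (a : A) (m : M) : mkRes f X (f a • m) = a • mkRes f X m :=
  map_smul (mk (R := A) (M := (ModuleCat.restrictScalars f).obj M) X) a
    (show (ModuleCat.restrictScalars f).obj M from m)

end LinTensor

/-! ### The inverse laws on coordinate rings -/

namespace AffineGroupoid

variable {A B : Type v} [CommRing A] [CommRing B] (G : AffineGroupoid A B)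

/-- The homomorphism `B ⊗_A B →+* B`, `b ⊗ c ↦ inv(b) c`, i.e. the map `g ↦ (g⁻¹, g)`. -/
def invLeft : Fib G.p₂ G.p₁ →+* B :=
  Fib.lift G.p₂ G.p₁ G.inv (RingHom.id B) (by rw [G.inv_p₂, RingHom.id_comp])

/-- The homomorphism `B ⊗_A B →+* B`, `b ⊗ c ↦ b inv(c)`, i.e. the map `g ↦ (g, g⁻¹)`. -/
def invRight : Fib G.p₂ G.p₁ →+* B :=
  Fib.lift G.p₂ G.p₁ (RingHom.id B) G.inv (by rw [G.inv_p₁, RingHom.id_comp])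

/-- Dual to `g⁻¹ g` being the unit at the `p₂`-end of `g`. -/
theorem invLeft_mult (b : B) : G.invLeft (G.mult b) = G.p₂ (G.unit b) :=
  RingHom.congr_fun (G.inv_mul B (RingHom.id B) (by rw [RingHom.id_comp, RingHom.id_comp,
    G.inv_p₂])) b

/-- Dual to `g g⁻¹` being the unit at the `p₁`-end of `g`. -/
theorem invRight_mult (b : B) : G.invRight (G.mult b) = G.p₁ (G.unit b) :=
  RingHom.congr_fun (G.mul_inv B (RingHom.id B) (by rw [RingHom.id_comp, RingHom.id_comp,
    G.inv_p₁])) b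

theorem invLeft_tmul (b c : B) :
    G.invLeft ((b : AlgOf G.p₂) ⊗ₜ[A] (c : AlgOf G.p₁)) = G.inv b * c := rfl

theorem invRight_tmul (b c : B) :
    G.invRight ((b : AlgOf G.p₂) ⊗ₜ[A] (c : AlgOf G.p₁)) = b * G.inv c := rfl

end AffineGroupoid

/-! ### Untwisting by inverse arrows -/

namespace GroupoidActionData

open BaseChange GroupoidAction LinTensor

variable {A B : Type v} [CommRing A] [CommRing B] {G : AffineGroupoid A B}
  {C : Type u} [Category.{v} C] [Preadditive C] [Linear A C] [HasColimits C]
  (α : GroupoidActionData G C) (X : C) (M N : ModuleCat.{v} B)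

/-- The object of `C` underlying `M ⊗_B act^*(X)`. -/
def tensAct : C := (LinTensor.tens B M (α.act.obj X)).obj

variable {M N} in
/-- The map `act^*(X) ⟶ M ⊗_B act^*(X)`, `x ↦ m ⊗ x`. -/
def mkAct : M →+ (α.total.obj X ⟶ α.tensAct X M) where
  toFun m := (LinTensor.mk (α.act.obj X) m).hom
  map_zero' := congrArg Hom.hom (map_zero (LinTensor.mk (R := B) (M := M) (α.act.obj X)))
  map_add' m n := congrArg Hom.hom (map_add (LinTensor.mk (R := B) (M := M) (α.act.obj X)) m n)

variable {M N} in
/-- The functoriality of `M ⊗_B act^*(X)` in `M`. -/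
def mapAct (i : M ⟶ N) : α.tensAct X M ⟶ α.tensAct X N :=
  ((LinTensor.functor B (α.act.obj X)).map i).hom

variable {M N} in
theorem mkAct_mapAct (i : M ⟶ N) (m : M) :
    α.mkAct X m ≫ α.mapAct X i = α.mkAct X (i m) :=
  congrArg Hom.hom ((LinTensor.mk_map i.hom (𝟙 (α.act.obj X)) m).trans (Category.id_comp _))

variable {M} in
theorem scalar_mkAct (b : B) (m : M) : α.scalar X b ≫ α.mkAct X m = α.mkAct X (b • m) :=
  congrArg Hom.hom (map_smul (LinTensor.mk (α.act.obj X)) b m).symm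

variable {X M} in
theorem total_tensAct_hom_ext {W : C} {s t : α.total.obj (α.tensAct X M) ⟶ W}
    (w : ∀ m : M, α.total.map (α.mkAct X m) ≫ s = α.total.map (α.mkAct X m) ≫ t) : s = t :=
  LinTensor.preserves_hom_ext (forget C G.p₁ ⋙ α.total) (R := B) w

variable {X M} in
theorem exists_total_tensAct_desc {W : C} (g : M →+ (α.total.obj (α.total.obj X) ⟶ W))
    (hg : ∀ b m, g (b • m) = α.total.map (α.scalar X b) ≫ g m) :
    ∃ s : α.total.obj (α.tensAct X M) ⟶ W, ∀ m, α.total.map (α.mkAct X m) ≫ s = g m :=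
  LinTensor.exists_preserves_desc (forget C G.p₁ ⋙ α.total) (R := B) (X := α.act.obj X) g
    fun b m => (hg b m).trans
      (congrArg (fun k => α.total.map k ≫ g m) (Category.comp_id (α.scalar X b)).symm)

/-- The comparison `act^*(M ⊗_A X) ⟶ M ⊗_B act^*(X)`. -/
theorem exists_total_tensRes_desc :
    ∃ e : α.total.obj (tensRes G.p₂ X M) ⟶ α.tensAct X M,
      ∀ m : M, α.total.map (mkRes G.p₂ X m) ≫ e = α.mkAct X m :=
  LinTensor.exists_preserves_desc α.total (R := A)
    (M := (ModuleCat.restrictScalars G.p₂).obj M) (X := X) (α.mkAct X) fun a m => by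
      rw [total_map_smul]
      exact (α.scalar_mkAct X (G.p₂ a) m).symm

variable {X M N} in
/-- A map `s : act^*(M ⊗_B act^*(X)) ⟶ M ⊗_A X` is an untwisting map if it is given by
`(b ⊗ c) δ(x) ⊗ m ↦ inv(b) c m ⊗ x`. -/
def IsUntwist (s : α.total.obj (α.tensAct X M) ⟶ tensRes G.p₂ X M) : Prop :=
  ∀ (m : M) (b c : B), α.comult X ≫ α.scalar _ b ≫ α.total.map (α.scalar X c) ≫
    α.total.map (α.mkAct X m) ≫ s = α.counit X ≫ mkRes G.p₂ X ((G.inv b * c) • m)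

/-- For fixed `m` the formula respects `mult(b) r δ(x) = r δ(b x)`: on one side `invLeft(mult(b)) =
p₂(unit(b))` crosses the tensor product over `A` as the scalar `unit(b)`, on the other `ε(b x) =
unit(b) ε(x)`. It is also balanced over `B` in `m`, since a scalar may be absorbed either in `c` or
in `m`. -/
theorem exists_isUntwist : ∃ s : α.total.obj (α.tensAct X M) ⟶ tensRes G.p₂ X M, α.IsUntwist s := by
  have h (m : M) : ∃ s : α.total.obj (α.total.obj X) ⟶ tensRes G.p₂ X M, ∀ b c : B,
      α.comult X ≫ α.scalar _ b ≫ α.total.map (α.scalar X c) ≫ s =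
        α.counit X ≫ mkRes G.p₂ X ((G.inv b * c) • m) :=
    α.exists_comult_desc
      { toFun := fun r => α.counit X ≫ mkRes G.p₂ X (G.invLeft r • m)
        map_zero' := by rw [map_zero, zero_smul, map_zero, comp_zero]
        map_add' := fun r s => by rw [map_add, add_smul, map_add, Preadditive.comp_add] }
      fun b r => by
        change α.counit X ≫ mkRes G.p₂ X (G.invLeft (G.mult b * r) • m) =
          α.scalar X b ≫ α.counit X ≫ mkRes G.p₂ X (G.invLeft r • m)
        rw [map_mul, G.invLeft_mult, mul_smul, mkRes_smul, ← Category.assoc, scalar_counit,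
          Linear.comp_smul, Linear.smul_comp]
  choose σ hσ using h
  obtain ⟨s, hs⟩ := α.exists_total_tensAct_desc (X := X) (M := M) (AddMonoidHom.mk' σ fun m n =>
    α.comult_hom_ext fun b c => by
      simp only [Preadditive.comp_add, hσ, smul_add, map_add]) fun b m => by
    refine α.comult_hom_ext fun b' c => ?_
    change _ ≫ _ ≫ _ ≫ σ _ = _ ≫ _ ≫ _ ≫ _ ≫ σ _
    rw [hσ, ← Category.assoc (α.total.map _), ← α.total.map_comp, ← scalar_mul, hσ, ← mul_smul,
      mul_assoc, mul_comm c b]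
  exact ⟨s, fun m b c => by rw [hs]; exact hσ m b c⟩

variable {X M N α} in
theorem IsUntwist.naturality {s : α.total.obj (α.tensAct X M) ⟶ tensRes G.p₂ X M}
    {t : α.total.obj (α.tensAct X N) ⟶ tensRes G.p₂ X N} (hs : α.IsUntwist s) (ht : α.IsUntwist t)
    (i : M ⟶ N) : α.total.map (α.mapAct X i) ≫ t = s ≫ mapRes G.p₂ X i := by
  refine α.total_tensAct_hom_ext fun m => α.comult_hom_ext fun b c => ?_
  rw [← Category.assoc (α.total.map (α.mkAct X m)), ← α.total.map_comp, mkAct_mapAct, ht]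
  have := hs m b c =≫ mapRes G.p₂ X i
  simp only [Category.assoc] at this
  rw [this, mkRes_mapRes, map_smul (ConcreteCategory.hom i)]

end GroupoidActionData

/-! ### Injectivity and exactness for tensor products with `act^*(X)` -/

namespace GroupoidAction

open GroupoidActionData LinTensor

variable {A B : Type v} [CommRing A] [CommRing B] {G : AffineGroupoid A B}
  {C : Type u} [Category.{v} C] [Preadditive C] [Linear A C] [HasColimits C]
  (α : GroupoidAction G C) {X : C} {M N : ModuleCat.{v} B}

theorem comult_counit (X : C) : α.comult X ≫ α.counit (α.total.obj X) = 𝟙 _ := α.counit_left X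

theorem comult_map_counit (X : C) : α.comult X ≫ α.total.map (α.counit X) = 𝟙 _ :=
  α.counit_right X

theorem comult_comult (X : C) : α.comult X ≫ α.comult (α.total.obj X) =
    α.comult X ≫ α.total.map (α.comult X) := α.coassoc X

/-- Both sides are compared on the generators `(b ⊗ c) δ(x) ⊗ m`. Untwisting and then applying `e`
multiplies `m` by `invRight(mult(b)) c`, while the counit multiplies it by `p₁(unit(b)) c`; these
agree because `g g⁻¹ = 1`. -/
theorem comult_untwist {s : α.total.obj (α.tensAct X M) ⟶ tensRes G.p₂ X M} (hs : α.IsUntwist s)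
    {e : α.total.obj (tensRes G.p₂ X M) ⟶ α.tensAct X M}
    (he : ∀ m : M, α.total.map (mkRes G.p₂ X m) ≫ e = α.mkAct X m) :
    α.comult (α.tensAct X M) ≫ α.total.map s ≫ e = α.counit (α.tensAct X M) := by
  have key_tmul (c : B) (m : M) (b b' : B) :
      α.comult X ≫ α.comult (α.total.obj X) ≫
        α.scalar₂ (α.total.obj X) ((b : AlgOf G.p₂) ⊗ₜ[A] (b' : AlgOf G.p₁)) ≫
        α.total.map (α.total.map (α.scalar X c) ≫ α.total.map (α.mkAct X m) ≫ s) ≫ e =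
      α.mkAct X ((G.invRight ((b : AlgOf G.p₂) ⊗ₜ[A] (b' : AlgOf G.p₁)) * c) • m) := by
    have h1 := α.scalar₂_tmul (α.total.obj X) b b'
    have h2 := hs m b' c
    -- Coassociativity moves the second `δ` inside the outer functor, where the defining formula of
    -- `s` applies; the `ε` it produces then cancels against the remaining `δ`.
    rw [h1, ← Category.assoc, comult_comult]
    simp only [Category.assoc]
    rw [← Category.assoc (α.total.map (α.scalar _ b')), ← α.total.map_comp,
      ← Category.assoc (α.total.map (α.comult X)), ← scalar_comp, Category.assoc,
      ← Category.assoc (α.total.map (α.comult X)), ← α.total.map_comp, h2,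
      α.total.map_comp, Category.assoc, he, ← Category.assoc (α.scalar _ b), scalar_comp,
      Category.assoc, scalar_mkAct, ← Category.assoc, comult_map_counit, Category.id_comp,
      ← mul_smul, G.invRight_tmul, mul_assoc]
  have key (c : B) (m : M) (r : Fib G.p₂ G.p₁) :
      α.comult X ≫ α.comult (α.total.obj X) ≫ α.scalar₂ (α.total.obj X) r ≫
        α.total.map (α.total.map (α.scalar X c) ≫ α.total.map (α.mkAct X m) ≫ s) ≫ e =
      α.mkAct X ((G.invRight r * c) • m) := by
    induction r using TensorProduct.induction_on with
    | zero => rw [map_zero, map_zero, zero_mul, zero_smul, map_zero, zero_comp, comp_zero,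
        comp_zero]
    | tmul b b' => exact key_tmul c m b b'
    | add x y hx hy =>
      rw [map_add, map_add, add_mul, add_smul, map_add, ← hx, ← hy, Preadditive.add_comp,
        Preadditive.comp_add, Preadditive.comp_add]
  refine α.total_tensAct_hom_ext fun m => α.comult_hom_ext fun b c => ?_
  have hr : α.comult X ≫ α.scalar _ b ≫ α.total.map (α.scalar X c) ≫
      α.total.map (α.mkAct X m) ≫ α.counit _ = α.mkAct X ((G.p₁ (G.unit b) * c) • m) := by
    rw [counit_naturality, ← Category.assoc (α.total.map _), counit_naturality, Category.assoc,
      ← Category.assoc (α.scalar _ b), scalar_counit, Linear.smul_comp, Linear.comp_smul,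
      ← Category.assoc, comult_counit, Category.id_comp, scalar_mkAct, mul_smul,
      ← scalar_mkAct _ _ (G.p₁ _), scalar_algebra, Linear.smul_comp, Category.id_comp]
  -- Naturality of `δ` brings it next to the scalar `b`, and passing `b` through `δ` turns it into
  -- `mult(b)`, so `key` applies with `r = mult(b)`.
  rw [hr, ← G.invRight_mult, ← key, ← Category.assoc (α.total.map (α.mkAct X m)),
    comult_naturality, Category.assoc, ← Category.assoc (α.total.map (α.scalar X c)),
    comult_naturality, Category.assoc, ← Category.assoc (α.scalar _ b), scalar_comult]
  simp only [α.total.map_comp, Category.assoc]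

/-- If `M ⊗_A X ⟶ N ⊗_A X` is a monomorphism, then so is
`M ⊗_B act^*(X) ⟶ N ⊗_B act^*(X)`. -/
theorem mono_mapAct (i : M ⟶ N) [Mono (mapRes G.p₂ X i)] :
    Mono (α.mapAct X i) := by
  obtain ⟨s, hs⟩ := α.exists_isUntwist X M
  obtain ⟨t, ht⟩ := α.exists_isUntwist X N
  obtain ⟨e, he⟩ := α.exists_total_tensRes_desc X M
  refine Preadditive.mono_of_cancel_zero _ fun {K} k hk => ?_
  have h1 : α.total.map k ≫ s = 0 := by
    rw [← cancel_mono (mapRes G.p₂ X i), Category.assoc, ← hs.naturality ht, ← Category.assoc,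
      ← α.total.map_comp, hk, α.total.map_zero, zero_comp, zero_comp]
  -- Since the counit at `K` is an epimorphism, it suffices that `k ∘ ε = ε ∘ T(k) = e ∘ T(s ∘ T(k))
  -- ∘ δ` vanishes, where `T` is `total`.
  rw [← cancel_epi (α.counit K), comp_zero, ← counit_naturality, ← α.comult_untwist hs he,
    ← Category.assoc, comult_naturality, Category.assoc, ← Category.assoc (α.total.map _),
    ← α.total.map_comp, h1, α.total.map_zero, zero_comp, comp_zero]

/-- Right exactness is automatic because the tensor functor preserves cokernels, and a monomorphism
on underlying objects in `C` is enough on the left. -/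
theorem shortExact_tensor {C : Type u} [Category.{v} C] [Abelian C] [Linear A C] [HasColimits C]
    (α : GroupoidAction G C) (X : C) {S : ShortComplex (ModuleCat.{v} B)} (hS : S.ShortExact)
    (h : Mono ((LinTensor.functor A X).map ((ModuleCat.restrictScalars G.p₂).map S.f))) :
    (S.map (LinTensor.functor B (α.act.obj X))).ShortExact := by
  have : Epi S.g := hS.epi_g
  have : Mono (mapRes G.p₂ X S.f) := h
  exact BaseChange.shortExact_of_isColimit _
    (CokernelCofork.mapIsColimit _ hS.exact.gIsCokernel (LinTensor.functor B (α.act.obj X)))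
    (α.mono_mapAct S.f)

end GroupoidAction

end

theorem lemma14 {A B : Type v} [CommRing A] [CommRing B] (G : AffineGroupoid A B)
    (hG : G.IsFlat) {C : Type u} [Category.{v} C] [Abelian C] [Linear A C] [HasColimits C]
    [AB5 C] (α : GroupoidAction G C) :
    (∀ (X : C) (S : ShortComplex (ModuleCat.{v} B)), S.ShortExact →
      Module.Flat A ((ModuleCat.restrictScalars G.p₂).obj S.X₃) →
        (S.map (LinTensor.functor B (α.act.obj X))).ShortExact) ∧
    (∀ X : C, LinTensor.IsFlat A X → LinTensor.IsFlat B (α.act.obj X)) := by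
  -- Restriction of scalars along `p₂` is exact, so both parts reduce to a short exact sequence of
  -- `A`-modules: in the first its quotient is flat, in the second `X` is.
  have hres (S : ShortComplex (ModuleCat.{v} B)) (hS : S.ShortExact) :
      (S.map (ModuleCat.restrictScalars G.p₂)).ShortExact := hS.map_of_exact _
  refine ⟨fun X S hS hflat => ?_, fun X hX S hS => ?_⟩
  · have hM := @ModuleCat.mono_map_of_flat A _ C _ _ _ _ (LinTensor.functor A X) inferInstance
      inferInstance _ (hres S hS) hflat
    exact α.shortExact_tensor X hS hM
  · exact α.shortExact_tensor X hS (hX _ (hres S hS)).mono_f
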